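/- Let $0<q<1$, and let $\mathrm{Pol}(\mathbb C)_q$ be the $*$-algebra with generator $z$ and relation $z^*z=q^2zz^*+1-q^2$; put $y=1-zz^*$. It acts on the space $H$ with basis $e_m$, $m\ge 0$, by $ze_m=e_{m+1}$, $z^*e_m=(1-q^{2m})e_{m-1}$. Let $D(U)_q'$ (distributions) be the completion of $\mathrm{Pol}(\mathbb C)_q$ with respect to the topology of convergence of all matrix elements in the basis $(e_m)$, that is, the space of all matrices $(f_{mn})_{m,n\ge0}$, and $D(U)_q$ (finite functions) the subspace of matrices with finitely many non-zero entries. Put $\int f\,d\mu=(1-q^2)\sum_m f_{mm}q^{2m}$ and $\int f\,d\nu=\int f\,y^{-2}d\mu$, and let $L^2(d\mu)_q$, $L^2(d\nu)_q\subset D(U)'_q$ be the completions of $D(U)_q$ for the scalar products $(f,g)=\int g^*f\,d\mu$, respectively $\int g^*f\,d\nu$. In the differential calculus with $dz\,z=q^2z\,dz$, $dz\,z^*=q^{-2}z^*dz$, $dz^*z=q^2z\,dz^*$, $dz^*z^*=q^{-2}z^*dz^*$, define (on distributions, by continuity) $\partial f=dz\,\frac{\partial^{(l)}f}{\partial z}$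 and $\bar\partial f=\frac{\partial^{(r)}f}{\partial z^*}\,dz^*$, and set $\int dz\, f\,dz^*=-2\pi i\int f\,d\mu$. Identify the function $f$ with the form $f\,dz^*$, so that $\bar\partial u=f$ means $\frac{\partial^{(r)}u}{\partial z^*}=f$. Let $D(U\times U)'_q$ be the analogous completion of $\mathrm{Pol}(\mathbb C)_q^{op}\otimes \mathrm{Pol}(\mathbb C)_q$ (variables $z,\zeta$; braces denote its multiplication), and let $$G=-\sum_{m\ge1}\frac{q^{-2}-1}{q^{-2m}-1}\,\Bigl\{\bigl((1-\zeta\zeta^*)(1-z^*\zeta)^{-1}\bigr)^m\bigl((1-z^*z)(1-z\zeta^*)^{-1}\bigr)^m\Bigr\}.$$ The series converges in $D(U\times U)'_q$, and $G$ is the Green function of the Poisson equation: for every $f\in D(U)_q$ the distribution $w=\int G(z,\zeta)f(\zeta)\,d\nu$ lies in $L^2(d\nu)_q$ and solves $\Box w=f$, where $\Box=-\bar\partial^*\bar\partial$ and $\bar\partial:L^2(d\nu)_q\to L^2(d\mu)_q$; that is, $-\int\bigl(\frac{\partial^{(r)}g}{\partial z^*}\bigr)^{*}\frac{\partial^{(r)}w}{\partial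 z^*}\,d\mu=\int g^*f\,d\nu$ for all $g\in D(U)_q$. Moreover, for every $f\in D(U)_q$: 1. There is a unique $u\in L^2(d\mu)_q$ with $\bar\partial u=f$ that is orthogonal to the kernel of $\bar\partial$ in $L^2(d\mu)_q$. 2. This solution is $$u=-\frac1{2\pi i}\int d\zeta\,\frac{\partial^{(l)}}{\partial z}G(z,\zeta)\,d\zeta^*f(\zeta).$$ 3. One has $$f=-\frac1{2\pi i}\int(1-z\zeta^*)^{-1}(1-q^{-2}z\zeta^*)^{-1}\,d\zeta\, f(\zeta)\,d\zeta^*-\frac1{2\pi i}\int d\zeta\,\frac{\partial^{(l)}}{\partial z}G(z,\zeta)\,d\zeta^*\,\frac{\partial^{(r)}f}{\partial\zeta^*}.$$ Here $d\zeta^*f=(\eta f\eta^{-1})\,d\zeta^*$ and $g\,d\zeta=d\zeta\,(\eta^{-1}g\eta)$ with $\eta=1-\zeta\zeta^*$, by the commutation relations above. -/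

import Mathlib

namespace QDisc

noncomputable section

/-! ### Distributions in the quantum disc

`Pol(ℂ)_q` is generated by `z, z*` with `z* z = q² z z* + 1 - q²`.  It acts on `H`, with basis
`e_m = z^m v₀`, by `z e_m = e_{m+1}`, `z* e_m = (1 - q^{2m}) e_{m-1}`.  The space `D(U)'_q` is the
completion of `Pol(ℂ)_q` in the topology of convergence of all matrix elements; it is identified
with the space of all infinite matrices `T(f) = (l_{mn}(f))` through `f e_n = ∑_m l_{mn}(f) e_m`,
with the topology of entrywise convergence.  In terms of the decomposition
`f = ∑_{m>0} z^m ψ_m(y) + ψ_0(y) + ∑_{m>0} ψ_{-m}(y) z*^m`, `y = 1 - z z*`, the diagonal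
entries are `l_{mm}(f) = ψ_0(q^{2m})`. -/

/-- Distributions `D(U)'_q` in the quantum disc, as infinite matrices. -/
abbrev Distr : Type := ℕ → ℕ → ℂ

/-- Finite functions `D(U)_q`: the matrices with finitely many non-zero entries. -/
def IsFin (f : Distr) : Prop := {p : ℕ × ℕ | f p.1 p.2 ≠ 0}.Finite

/-- The unit `1`. -/
def one : Distr := fun m n => if m = n then 1 else 0

/-- `f ↦ z f`. -/
def zL (f : Distr) : Distr := fun m n => if m = 0 then 0 else f (m - 1) n

/-- `f ↦ f z`. -/
def zR (f : Distr) : Distr := fun m n => f m (n + 1)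

/-- `f ↦ z* f`. -/
def zsL (q : ℝ) (f : Distr) : Distr := fun m n => (1 - (q : ℂ) ^ (2 * (m + 1))) * f (m + 1) n

/-- `f ↦ f z*`. -/
def zsR (q : ℝ) (f : Distr) : Distr :=
  fun m n => if n = 0 then 0 else (1 - (q : ℂ) ^ (2 * n)) * f m (n - 1)

/-- `f ↦ y^s f`, where `y = 1 - z z*` acts by `y e_m = q^{2m} e_m`. -/
def yL (q : ℝ) (s : ℤ) (f : Distr) : Distr := fun m n => (q : ℂ) ^ (2 * s * (m : ℤ)) * f m n

/-- `f ↦ f y^s`. -/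
def yR (q : ℝ) (s : ℤ) (f : Distr) : Distr := fun m n => f m n * (q : ℂ) ^ (2 * s * (n : ℤ))

/-- The product (an infinite sum in general; a finite one as soon as one factor is finite). -/
def mul (f g : Distr) : Distr := fun m n => ∑' k, f m k * g k n

/-- `(q²; q²)_m`, the squared norm of `e_m` in the pre-Hilbert space `H`. -/
def poch (q : ℝ) (m : ℕ) : ℝ := ∏ j ∈ Finset.range m, (1 - q ^ (2 * (j + 1)))

/-- The involution `f ↦ f*`: the adjoint matrix for `(e_j, e_m) = δ_{jm} (q²; q²)_m`. -/
def adj (q : ℝ) (f : Distr) : Distr :=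
  fun m n => (starRingEnd ℂ) (f n m) * ((poch q n / poch q m : ℝ) : ℂ)

/-- The normalized Lebesgue integral `∫ f dμ = (1 - q²) ∑_m ψ_0(q^{2m}) q^{2m}`. -/
def mu (q : ℝ) (f : Distr) : ℂ := (1 - (q : ℂ) ^ 2) * ∑' m : ℕ, f m m * (q : ℂ) ^ (2 * m)

/-! ### Hilbert spaces

The completion of `D(U)_q` for the scalar product `(f, g) = ∫ g* f (1 - z z*)^s dμ` is realized
inside `D(U)'_q`, as a weighted `ℓ²` space of matrices (the matrix units are orthogonal in it).
The case `s = 0` is `L²(dμ)_q`, the case `s = -2` is `L²(dν)_q`, `dν = (1 - z z*)^{-2} dμ`. -/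

/-- Membership in the Hilbert space: `∫ f* f (1 - z z*)^s dμ < ∞`. -/
def MemL2 (q : ℝ) (s : ℤ) (f : Distr) : Prop :=
  Summable fun p : ℕ × ℕ =>
    ‖f p.1 p.2‖ ^ 2 * (poch q p.1 / poch q p.2) * q ^ (2 * (s + 1) * (p.2 : ℤ))

/-- The scalar product `(f, g) = ∫ g* f (1 - z z*)^s dμ`. -/
def scal (q : ℝ) (s : ℤ) (f g : Distr) : ℂ :=
  (1 - (q : ℂ) ^ 2) *
    ∑' p : ℕ × ℕ, adj q g p.2 p.1 * f p.1 p.2 * (q : ℂ) ^ (2 * (s + 1) * (p.2 : ℤ))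

/-! ### Differential calculus

The forms satisfy `dz z = q² z dz`, `dz z* = q^{-2} z* dz`, `dz* z = q² z dz*`,
`dz* z* = q^{-2} z* dz*`.  Since `y z y⁻¹ = q² z` and `y z* y⁻¹ = q^{-2} z*`, this says
`dz f = (y f y⁻¹) dz` and `dz* f = (y f y⁻¹) dz*`. -/

/-- `f ↦ y f y⁻¹`, so that `dz* f = (conj f) dz*` and `dz f = (conj f) dz`. -/
def conj (q : ℝ) (f : Distr) : Distr := yL q 1 (yR q (-1) f)

/-- `f ↦ y⁻¹ f y`, so that `f dz = dz (conjInv f)`. -/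
def conjInv (q : ℝ) (f : Distr) : Distr := yL q (-1) (yR q 1 f)

/-- The right derivative `∂^{(r)} f / ∂z*`, defined by `∂̄ f = (∂^{(r)} f / ∂z*) dz*`, explicitly
`(1 - q²)⁻¹ (f z - z f) y⁻¹`.  It is the continuous operator on distributions with `∂̄ 1 = 0`,
`∂̄ (f z) = (∂̄ f) z`, `∂̄ (f z*) = (∂̄ f) z* + f dz*`; see `dzbar_one`, `dzbar_mul_z`,
`dzbar_mul_zs` below. -/
def dzbar (q : ℝ) (f : Distr) : Distr := (1 - (q : ℂ) ^ 2)⁻¹ • yR q (-1) (zR f - zL f)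

/-- The left derivative `∂^{(l)} f / ∂z`, defined by `∂ f = dz (∂^{(l)} f / ∂z)`, explicitly
`(1 - q²)⁻¹ y⁻¹ (z* f - f z*)`.  It is the continuous operator on distributions with `∂ 1 = 0`,
`∂ (z* f) = z* ∂ f`, `∂ (z f) = z ∂ f + dz f`; see `dz_one`, `dz_zs_mul`, `dz_z_mul` below. -/
def dz (q : ℝ) (f : Distr) : Distr := (1 - (q : ℂ) ^ 2)⁻¹ • yL q (-1) (zsL q f - zsR q f)

/-- `w ∈ L²(dν)_q` solves the Poisson equation `□ w = f`, where `□ = -∂̄* ∂̄` and `∂̄*` is the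
adjoint of `∂̄ : L²(dν)_q → L²(dμ)_q` (a form `g dz*` having the norm of `g` in `L²(dμ)_q`):
the equation is tested against the dense subspace of finite functions. -/
def PoissonSol (q : ℝ) (f w : Distr) : Prop :=
  MemL2 q (-2) w ∧
    ∀ g : Distr, IsFin g → -scal q 0 (dzbar q w) (dzbar q g) = scal q (-2) f g

/-- `u ∈ L²(dμ)_q` solves the `∂̄`-problem: `∂̄ u = f dz*` and `u` is orthogonal to the
kernel of `∂̄` in `L²(dμ)_q`. -/
def DbarSol (q : ℝ) (f u : Distr) : Prop :=
  MemL2 q 0 u ∧ dzbar q u = f ∧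
    ∀ g : Distr, MemL2 q 0 g → dzbar q g = 0 → scal q 0 u g = 0

/-! ### Kernels

The space `D(U × U)'_q` is the completion of `Pol(ℂ)_q^{op} ⊗ Pol(ℂ)_q` in the topology of
convergence of the matrix elements in both tensor factors: `K a b c d` is the entry `(a, b)` in
the first variable `z` and `(c, d)` in the second variable `ζ`.  (The matrix elements of
`f` in the module `H^{op}` over the opposite algebra are proportional to the `l_{nm}(f)`.)
The product `{ · }` is opposite in the first factor: for instance, left multiplication by
`{z* ζ}` is right multiplication by `z*` in the first variable and left multiplication by `ζ` in
the second one. -/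

/-- Kernels `D(U × U)'_q`. -/
abbrev Ker : Type := ℕ → ℕ → ℕ → ℕ → ℂ

/-- A linear operator applied in the first variable `z`. -/
def inZ (T : Distr → Distr) (K : Ker) : Ker := fun a b c d => T (fun a' b' => K a' b' c d) a b

/-- A linear operator applied in the second variable `ζ`. -/
def inZeta (T : Distr → Distr) (K : Ker) : Ker := fun a b => T (K a b)

/-- The unit of `D(U × U)'_q`. -/
def oneK : Ker := fun a b c d => one a b * one c d

/-- `K ↦ {z* ζ K}`. -/
def shiftL (q : ℝ) (K : Ker) : Ker := inZ (zsR q) (inZeta zL K)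

/-- `K ↦ {K z ζ*}`. -/
def shiftR (q : ℝ) (K : Ker) : Ker := inZ zL (inZeta (zsR q) K)

/-- `K ↦ {(1 - z* ζ)⁻¹ K} = ∑_k {(z* ζ)^k K}`; the terms with `k > c` have vanishing
entries `a b c d`. -/
def geomL (q : ℝ) (K : Ker) : Ker :=
  fun a b c d => ∑ k ∈ Finset.range (c + 1), ((shiftL q)^[k] K) a b c d

/-- `K ↦ {K (1 - t z ζ*)⁻¹} = ∑_k t^k {K (z ζ*)^k}`; the terms with `k > d` have vanishing
entries `a b c d`. -/
def geomR (q : ℝ) (t : ℂ) (K : Ker) : Ker :=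
  fun a b c d => ∑ k ∈ Finset.range (d + 1), t ^ k * ((shiftR q)^[k] K) a b c d

/-- `K ↦ {(1 - ζ ζ*) (1 - z* ζ)⁻¹ K}`. -/
def factorL (q : ℝ) (K : Ker) : Ker := inZeta (yL q 1) (geomL q K)

/-- `K ↦ {K (1 - z* z) (1 - z ζ*)⁻¹}`; here `{1 - z* z}` is the element `y = 1 - z z*` of
`Pol(ℂ)_q`, and it multiplies from the right in the opposite algebra. -/
def factorR (q : ℝ) (K : Ker) : Ker := geomR q 1 (inZ (yL q 1) K)

/-- `G_m = {((1 - ζ ζ*) (1 - z* ζ)⁻¹)^m ((1 - z* z) (1 - z ζ*)⁻¹)^m}`. -/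
def greenTerm (q : ℝ) (m : ℕ) : Ker := (factorL q)^[m] ((factorR q)^[m] oneK)

/-- The `m`-th term `-(q^{-2} - 1) / (q^{-2m} - 1) G_m` of the Green function, with `m`
replaced by `m + 1` so that the summation starts at `0`. -/
def greenSummand (q : ℝ) (m : ℕ) : Ker :=
  (-(((q : ℂ) ^ (-2 : ℤ) - 1) / ((q : ℂ) ^ (-2 * ((m : ℤ) + 1)) - 1))) • greenTerm q (m + 1)

/-- The Green function `G = -∑_{m ≥ 1} (q^{-2} - 1) / (q^{-2m} - 1) G_m`, an entrywise sum. -/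
def green (q : ℝ) : Ker := fun a b c d => ∑' m : ℕ, greenSummand q m a b c d

/-- `(1 - z ζ*)⁻¹ (1 - q^{-2} z ζ*)⁻¹`. -/
def bergman (q : ℝ) : Ker := geomR q ((q : ℂ) ^ (-2 : ℤ)) (geomR q 1 oneK)

/-- The integral operator `∫ K(z, ζ) f(ζ) dμ = (id ⊗ μ)(K (1 ⊗ f))`. -/
def intMu (q : ℝ) (K : Ker) (f : Distr) : Distr := fun a b => mu q (mul (K a b) f)

/-- The integral operator `∫ K(z, ζ) f(ζ) dν`, with `∫ f dν = ∫ f (1 - z z*)^{-2} dμ`. -/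
def intNu (q : ℝ) (K : Ker) (f : Distr) : Distr := fun a b => mu q (yR q (-2) (mul (K a b) f))

/-- `∫ dζ K(z, ζ) f(ζ) dζ*`, where `∫ dζ h dζ* = -2πi ∫ h dμ`. -/
def intForm (q : ℝ) (K : Ker) (f : Distr) : Distr :=
  (-(2 * (Real.pi : ℂ) * Complex.I)) • intMu q K f

/-- `∫ dζ K(z, ζ) dζ* f(ζ)`, where `dζ* f = (conj f) dζ*`. -/
def intFormRight (q : ℝ) (K : Ker) (f : Distr) : Distr := intForm q K (conj q f)

/-- `∫ K(z, ζ) dζ f(ζ) dζ*`, where `g dζ = dζ (conjInv g)`. -/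
def intFormLeft (q : ℝ) (K : Ker) (f : Distr) : Distr := intForm q (inZeta (conjInv q) K) f

/-! ### Checks of the definitions -/

theorem rel_left (q : ℝ) (f : Distr) :
    zsL q (zL f) = (q : ℂ) ^ 2 • zL (zsL q f) + (1 - (q : ℂ) ^ 2) • f := by
  funext m n
  rcases m with _ | m
  · simp [zL, zsL]
  · simp [zL, zsL]; ring

theorem rel_right (q : ℝ) (f : Distr) :
    zR (zsR q f) = (q : ℂ) ^ 2 • zsR q (zR f) + (1 - (q : ℂ) ^ 2) • f := by
  funext m n
  rcases n with _ | n
  · simp [zR, zsR]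
  · simp [zR, zsR]; ring

theorem yL_one_eq (q : ℝ) (f : Distr) : yL q 1 f = f - zL (zsL q f) := by
  funext m n
  rcases m with _ | m
  · simp [zL, yL]
  · simp only [yL, zL, zsL, Pi.sub_apply]
    have : (2 * 1 * ((m + 1 : ℕ) : ℤ)) = ((2 * (m + 1) : ℕ) : ℤ) := by push_cast; ring
    rw [this, zpow_natCast]
    simp
    ring

theorem dzbar_one (q : ℝ) : dzbar q one = 0 := by
  funext m n
  rcases m with _ | m <;> simp [dzbar, yR, zR, zL, one]

theorem dzbar_mul_z (q : ℝ) (hq : q ≠ 0) (f : Distr) :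
    dzbar q (zR f) = (q : ℂ) ^ 2 • zR (dzbar q f) := by
  have hq' : (q : ℂ) ≠ 0 := by exact_mod_cast hq
  funext m n
  have h : (q : ℂ) ^ (2 * (-1 : ℤ) * ((n : ℕ) : ℤ))
      = (q : ℂ) ^ 2 * (q : ℂ) ^ (2 * (-1 : ℤ) * ((n + 1 : ℕ) : ℤ)) := by
    rw [← zpow_natCast, ← zpow_add₀ hq']; congr 1; push_cast; ring
  simp only [dzbar, yR, zR, zL, Pi.smul_apply, Pi.sub_apply, smul_eq_mul, h]
  ring

theorem dzbar_mul_zs (q : ℝ) (hq : q ≠ 0) (hq1 : q ^ 2 ≠ 1) (f : Distr) :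
    dzbar q (zsR q f) = (q : ℂ) ^ (-2 : ℤ) • zsR q (dzbar q f) + f := by
  have hq' : (q : ℂ) ≠ 0 := by exact_mod_cast hq
  have hq2 : 1 - (q : ℂ) ^ 2 ≠ 0 := by
    rw [sub_ne_zero]; exact_mod_cast hq1.symm
  funext m n
  rcases n with _ | n
  · rcases m with _ | m <;> simp [dzbar, yR, zR, zL, zsR, hq2]
  · have h : (q : ℂ) ^ (2 * (-1 : ℤ) * ((n : ℕ) : ℤ))
        = (q : ℂ) ^ 2 * (q : ℂ) ^ (2 * (-1 : ℤ) * ((n + 1 : ℕ) : ℤ)) := by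
      rw [← zpow_natCast, ← zpow_add₀ hq']; congr 1; push_cast; ring
    have h2 : (q : ℂ) ^ (2 * (-1 : ℤ) * ((n + 1 : ℕ) : ℤ)) * (q : ℂ) ^ (2 * (n + 1)) = 1 := by
      rw [← zpow_natCast, ← zpow_add₀ hq', ← zpow_zero (q : ℂ)]; congr 1; push_cast; ring
    have h3 : (q : ℂ) ^ (-2 : ℤ) * (q : ℂ) ^ 2 = 1 := by
      rw [← zpow_natCast, ← zpow_add₀ hq', ← zpow_zero (q : ℂ)]; congr 1
    have h4 : (q : ℂ) ^ (2 * (n + 1 + 1)) = (q : ℂ) ^ (2 * (n + 1)) * (q : ℂ) ^ 2 := by ring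
    have h5 : (1 - (q : ℂ) ^ 2)⁻¹ * (1 - (q : ℂ) ^ 2) = 1 := inv_mul_cancel₀ hq2
    have h6 : zL (zsR q f) m (n + 1) = (1 - (q : ℂ) ^ (2 * (n + 1))) * zL f m n := by
      rcases m with _ | m <;> simp [zL, zsR]
    have h7 : zR (zsR q f) m (n + 1)
        = (1 - (q : ℂ) ^ (2 * (n + 1)) * (q : ℂ) ^ 2) * f m (n + 1) := by
      simp [zR, zsR, h4]
    have h8 : zsR q (dzbar q f) m (n + 1)
        = (1 - (q : ℂ) ^ (2 * (n + 1))) * dzbar q f m n := by simp [zsR]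
    have h9 : dzbar q (zsR q f) m (n + 1) = (1 - (q : ℂ) ^ 2)⁻¹ *
        ((zR (zsR q f) m (n + 1) - zL (zsR q f) m (n + 1))
          * (q : ℂ) ^ (2 * (-1 : ℤ) * ((n + 1 : ℕ) : ℤ))) := rfl
    have h10 : dzbar q f m n = (1 - (q : ℂ) ^ 2)⁻¹ *
        ((f m (n + 1) - zL f m n) * (q : ℂ) ^ (2 * (-1 : ℤ) * (n : ℤ))) := rfl
    simp only [Pi.add_apply, Pi.smul_apply, smul_eq_mul]
    rw [h8, h9, h10, h6, h7, h]
    generalize (q : ℂ) ^ (2 * (-1 : ℤ) * ((n + 1 : ℕ) : ℤ)) = A at *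
    generalize (q : ℂ) ^ (-2 : ℤ) = B at *
    generalize (q : ℂ) ^ (2 * (n + 1)) = C at *
    generalize (q : ℂ) ^ 2 = D at *
    generalize (1 - D)⁻¹ = E at *
    linear_combination (E * (1 - D) * f m (n + 1)) * h2 + f m (n + 1) * h5
      - (E * (1 - C) * (f m (n + 1) - zL f m n) * A) * h3

theorem dz_one (q : ℝ) : dz q one = 0 := by
  funext m n
  rcases n with _ | n
  · simp [dz, yL, zsL, zsR, one]
  · by_cases h : m = n
    · subst h; simp [dz, yL, zsL, zsR, one]
    · simp [dz, yL, zsL, zsR, one, h]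

theorem dz_zs_mul (q : ℝ) (hq : q ≠ 0) (f : Distr) :
    dz q (zsL q f) = (q : ℂ) ^ 2 • zsL q (dz q f) := by
  have hq' : (q : ℂ) ≠ 0 := by exact_mod_cast hq
  funext m n
  have h : (q : ℂ) ^ (2 * (-1 : ℤ) * ((m : ℕ) : ℤ))
      = (q : ℂ) ^ 2 * (q : ℂ) ^ (2 * (-1 : ℤ) * ((m + 1 : ℕ) : ℤ)) := by
    rw [← zpow_natCast, ← zpow_add₀ hq']; congr 1; push_cast; ring
  simp only [dz, yL, zsL, zsR, Pi.smul_apply, Pi.sub_apply, smul_eq_mul, h]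
  split <;> ring

theorem dz_z_mul (q : ℝ) (hq : q ≠ 0) (hq1 : q ^ 2 ≠ 1) (f : Distr) :
    dz q (zL f) = (q : ℂ) ^ (-2 : ℤ) • zL (dz q f) + f := by
  have hq' : (q : ℂ) ≠ 0 := by exact_mod_cast hq
  have hq2 : 1 - (q : ℂ) ^ 2 ≠ 0 := by
    rw [sub_ne_zero]; exact_mod_cast hq1.symm
  have h5 : (1 - (q : ℂ) ^ 2)⁻¹ * (1 - (q : ℂ) ^ 2) = 1 := inv_mul_cancel₀ hq2
  funext m n
  rcases m with _ | m
  · rcases n with _ | n <;> simp [dz, yL, zL, zsL, zsR, hq2]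
  · have h : (q : ℂ) ^ (2 * (-1 : ℤ) * ((m : ℕ) : ℤ))
        = (q : ℂ) ^ 2 * (q : ℂ) ^ (2 * (-1 : ℤ) * ((m + 1 : ℕ) : ℤ)) := by
      rw [← zpow_natCast, ← zpow_add₀ hq']; congr 1; push_cast; ring
    have h2 : (q : ℂ) ^ (2 * (-1 : ℤ) * ((m + 1 : ℕ) : ℤ)) * (q : ℂ) ^ (2 * (m + 1)) = 1 := by
      rw [← zpow_natCast, ← zpow_add₀ hq', ← zpow_zero (q : ℂ)]; congr 1; push_cast; ring
    have h3 : (q : ℂ) ^ (-2 : ℤ) * (q : ℂ) ^ 2 = 1 := by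
      rw [← zpow_natCast, ← zpow_add₀ hq', ← zpow_zero (q : ℂ)]; congr 1
    have h4 : (q : ℂ) ^ (2 * (m + 1 + 1)) = (q : ℂ) ^ (2 * (m + 1)) * (q : ℂ) ^ 2 := by ring
    have h6 : zsR q (zL f) (m + 1) n = zsR q f m n := by
      rcases n with _ | n <;> simp [zL, zsR]
    have h7 : dz q (zL f) (m + 1) n = (1 - (q : ℂ) ^ 2)⁻¹ *
        ((q : ℂ) ^ (2 * (-1 : ℤ) * ((m + 1 : ℕ) : ℤ)) *
          ((1 - (q : ℂ) ^ (2 * (m + 1 + 1))) * f (m + 1) n - zsR q (zL f) (m + 1) n)) := rfl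
    have h8 : zL (dz q f) (m + 1) n = (1 - (q : ℂ) ^ 2)⁻¹ *
        ((q : ℂ) ^ (2 * (-1 : ℤ) * (m : ℤ)) *
          ((1 - (q : ℂ) ^ (2 * (m + 1))) * f (m + 1) n - zsR q f m n)) := by
      simp [zL, dz, yL, zsL]
    simp only [Pi.add_apply, Pi.smul_apply, smul_eq_mul]
    rw [h7, h8, h6, h, h4]
    generalize (q : ℂ) ^ (2 * (-1 : ℤ) * ((m + 1 : ℕ) : ℤ)) = A at *
    generalize (q : ℂ) ^ (-2 : ℤ) = B at *
    generalize (q : ℂ) ^ (2 * (m + 1)) = C at *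
    generalize (q : ℂ) ^ 2 = D at *
    generalize (1 - D)⁻¹ = E at *
    linear_combination (E * (1 - D) * f (m + 1) n) * h2 + f (m + 1) n * h5
      - (E * A * ((1 - C) * f (m + 1) n - zsR q f m n)) * h3

theorem scal_eq_mu (q : ℝ) (s : ℤ) (f g : Distr) (hq : q ≠ 0) (hf : IsFin f) :
    scal q s f g = mu q (yR q s (mul (adj q g) f)) := by
  have hq' : (q : ℂ) ≠ 0 := by exact_mod_cast hq
  unfold scal mu yR mul
  congr 1
  rw [← (Equiv.prodComm ℕ ℕ).tsum_eq]
  have hs : Summable fun p : ℕ × ℕ =>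
      adj q g p.1 p.2 * f p.2 p.1 * (q : ℂ) ^ (2 * (s + 1) * (p.1 : ℤ)) := by
    apply summable_of_hasFiniteSupport
    refine (hf.image Prod.swap).subset ?_
    rintro ⟨a, b⟩ h
    refine ⟨(b, a), ?_, rfl⟩
    intro h0
    apply h
    simp only at h0
    simp [h0]
  have h2 := hs.tsum_prod
  simp only [Equiv.prodComm_apply, Prod.fst_swap, Prod.snd_swap]
  rw [h2]
  congr 1
  funext b
  rw [← tsum_mul_right, ← tsum_mul_right]
  congr 1
  funext a
  have : (q : ℂ) ^ (2 * (s + 1) * (b : ℤ)) = (q : ℂ) ^ (2 * s * (b : ℤ)) * (q : ℂ) ^ (2 * b) := by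
    rw [← zpow_natCast, ← zpow_add₀ hq']; congr 1; push_cast; ring
  simp only [this]
  ring

end

end QDisc

open QDisc

namespace QDisc

noncomputable section

open Filter Topology

/-! ### `q`-factorials and `q`-binomial coefficients on the integers -/

/-! Write `t = q²`. Everything rests on a two-term relation for the Laplacian on the kernels `G_m`:
up to the factor `(1 - t)²`, `□ G_{m+1}` is `t^{-m} (1 - t^{m+1})` times `(1 - t^m) G_{m+1} - (1 -
t^{m+1}) G_{m+2}` (`lap_greenR`). The coefficient of `G_{m+1}` in the Green function is `-(1 - t)
t^m / (1 - t^{m+1})`, exactly what turns `□ G` into a telescoping series. Its initial term carries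
the factor `1 - t^0 = 0`, and its end term tends to the reproducing kernel, because `G_m` does so
entrywise as `m → ∞` (`tendsto_greenR`). Hence `lap_green`, and with Green's formula
`scal_dzbar_dzbar` the Poisson equation.

The relation itself comes from closed forms. Each factor of `G_m` is a Neumann series, hence
determined by a resolvent equation, and that equation is the `q`-Pascal rule. An entry of `G_m` is
thus a finite sum of products of `q`-binomials. On this sum the relation is proved summand by
summand, up to the difference of a certificate `certG` that vanishes at both ends.

For the `∂̄`-problem, `∂̄ ∂` is the Laplacian divided by `y` on each side (`dzbar_dz`). So if `w` is
the Green potential of `y f y`, then `u = ∂^{(l)} w / ∂z` satisfies `∂̄ u = f`. The kernel of `∂̄`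
consists of the power series in `z`, that is, of lower triangular matrices constant along diagonals.
Orthogonality to it therefore follows once every weighted sum of `u` along a diagonal on or below
the main one vanishes (`scal_eq_zero_of_diag`). For `u = dz w` these sums telescope, the boundary
terms vanishing by the decay `w_{ab} = O(t^b)`. A difference of two solutions is in the kernel and
orthogonal to it, hence zero.

The integral formula is then uniqueness again: the Bergman integral `P f` is the orthogonal
projection of `f` onto the kernel, so `f - P f` is the solution with data `∂̄ f`, and must equal the
one produced by the Green function. -/

theorem poch_zero (q : ℝ) : poch q 0 = 1 := by simp [poch]

theorem poch_succ (q : ℝ) (n : ℕ) : poch q (n + 1) = poch q n * (1 - (q ^ 2) ^ (n + 1)) := by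
  rw [poch, Finset.prod_range_succ, ← poch, pow_mul]

theorem one_sub_pow_pos {q : ℝ} (hq0 : 0 < q) (hq1 : q < 1) (n : ℕ) :
    0 < 1 - (q ^ 2) ^ (n + 1) := by
  have h : q ^ 2 < 1 := by nlinarith
  exact sub_pos.2 (pow_lt_one₀ (by positivity : 0 ≤ q ^ 2) h (Nat.succ_ne_zero n))

theorem poch_pos {q : ℝ} (hq0 : 0 < q) (hq1 : q < 1) (n : ℕ) : 0 < poch q n := by
  induction n with
  | zero => simp [poch_zero]
  | succ n ih => rw [poch_succ]; exact mul_pos ih (one_sub_pow_pos hq0 hq1 n)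

/-- The reciprocal `1 / (q²; q²)_n`, extended by zero to negative `n`. -/
def rpoch (q : ℝ) (n : ℤ) : ℝ := if n < 0 then 0 else (poch q n.toNat)⁻¹

/-- The `q²`-binomial coefficient `[m + l - 1, l]`, extended by zero to negative `l`. -/
def qbin (q : ℝ) (m : ℕ) (l : ℤ) : ℝ :=
  if l < 0 then 0 else
    ∏ j ∈ Finset.range l.toNat, (1 - (q ^ 2) ^ (m + j)) / (1 - (q ^ 2) ^ (j + 1))

theorem rpoch_natCast (q : ℝ) (n : ℕ) : rpoch q n = (poch q n)⁻¹ := by simp [rpoch]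

theorem rpoch_of_neg (q : ℝ) {n : ℤ} (h : n < 0) : rpoch q n = 0 := by simp [rpoch, h]

theorem qbin_natCast (q : ℝ) (m l : ℕ) : qbin q m l =
    ∏ j ∈ Finset.range l, (1 - (q ^ 2) ^ (m + j)) / (1 - (q ^ 2) ^ (j + 1)) := by
  simp [qbin]

theorem qbin_of_neg (q : ℝ) (m : ℕ) {l : ℤ} (h : l < 0) : qbin q m l = 0 := by simp [qbin, h]

theorem qbin_at_zero (q : ℝ) (m : ℕ) : qbin q m 0 = 1 := by simp [qbin]

theorem qbin_zero (q : ℝ) (l : ℤ) : qbin q 0 l = if l = 0 then 1 else 0 := by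
  rcases lt_or_ge l 0 with h | h
  · simp [qbin_of_neg q 0 h, h.ne]
  · lift l to ℕ using h
    rcases l with _ | l
    · simp [qbin]
    · rw [qbin_natCast, Finset.prod_range_succ']
      have : (l : ℤ) + 1 ≠ 0 := by omega
      simp [this]

/-- The extension by zero is compatible with this recursion because the factor `1 - t^n` vanishes at
`n = 0`; the same happens in `qbin_rec`. Integer indices thus remove all boundary cases from the
later identities. -/
theorem rpoch_sub_one {q : ℝ} (hq0 : 0 < q) (hq1 : q < 1) (n : ℤ) :
    rpoch q (n - 1) = (1 - (q ^ 2) ^ n) * rpoch q n := by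
  rcases lt_trichotomy n 0 with h | h | h
  · rw [rpoch_of_neg q h, rpoch_of_neg q (by omega), mul_zero]
  · subst h; simp [rpoch]
  · obtain ⟨k, rfl⟩ : ∃ k : ℕ, n = (k + 1 : ℕ) := ⟨(n - 1).toNat, by omega⟩
    have h1 : ((k + 1 : ℕ) : ℤ) - 1 = (k : ℕ) := by push_cast; ring
    rw [h1, rpoch_natCast, rpoch_natCast, zpow_natCast, poch_succ]
    have := (one_sub_pow_pos hq0 hq1 k).ne'
    have := (poch_pos hq0 hq1 k).ne'
    field_simp

theorem qbin_rec {q : ℝ} (hq0 : 0 < q) (hq1 : q < 1) (m : ℕ) (l : ℤ) :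
    (1 - (q ^ 2) ^ l) * qbin q m l = (1 - (q ^ 2) ^ (m + l - 1)) * qbin q m (l - 1) := by
  rcases lt_trichotomy l 0 with h | h | h
  · rw [qbin_of_neg q m h, qbin_of_neg q m (by omega), mul_zero, mul_zero]
  · subst h; simp [qbin]
  · obtain ⟨k, rfl⟩ : ∃ k : ℕ, l = (k + 1 : ℕ) := ⟨(l - 1).toNat, by omega⟩
    have h1 : ((k + 1 : ℕ) : ℤ) - 1 = (k : ℕ) := by push_cast; ring
    have h2 : (m : ℤ) + ((k + 1 : ℕ) : ℤ) - 1 = (m + k : ℕ) := by push_cast; ring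
    rw [h1, h2, qbin_natCast, qbin_natCast, zpow_natCast, zpow_natCast, Finset.prod_range_succ]
    have := (one_sub_pow_pos hq0 hq1 k).ne'
    field_simp

theorem qbin_succ (q : ℝ) (m : ℕ) (l : ℤ) :
    (1 - (q ^ 2) ^ m) * qbin q (m + 1) l = (1 - (q ^ 2) ^ (m + l)) * qbin q m l := by
  rcases lt_or_ge l 0 with h | h
  · rw [qbin_of_neg q m h, qbin_of_neg q _ h, mul_zero, mul_zero]
  · lift l to ℕ using h
    have h2 : (m : ℤ) + (l : ℤ) = (m + l : ℕ) := by push_cast; ring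
    rw [h2, qbin_natCast, qbin_natCast, zpow_natCast, Finset.prod_div_distrib,
      Finset.prod_div_distrib, ← mul_div_assoc, ← mul_div_assoc]
    congr 1
    -- Both sides are the product of `1 - t^{m+j}` over `0 ≤ j ≤ l`, with the first or the last
    -- factor split off.
    rw [mul_comm _ (∏ j ∈ Finset.range l, _), mul_comm _ (∏ j ∈ Finset.range l, _),
      ← Finset.prod_range_succ (fun j => 1 - (q ^ 2) ^ (m + j)), Finset.prod_range_succ']
    simp only [add_zero]
    congr 1
    exact Finset.prod_congr rfl fun j _ => by ring_nf

/-- The `q`-Pascal rule. -/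
theorem qbin_pascal {q : ℝ} (hq0 : 0 < q) (hq1 : q < 1) (m : ℕ) (l : ℤ) :
    qbin q (m + 1) l = qbin q (m + 1) (l - 1) + (q ^ 2) ^ l * qbin q m l := by
  rcases lt_trichotomy l 0 with h | h | h
  · rw [qbin_of_neg q _ h, qbin_of_neg q _ h, qbin_of_neg q _ (by omega)]; simp
  · subst h; simp [qbin]
  · have h1 := qbin_rec hq0 hq1 (m + 1) l
    have h2 := qbin_succ q m (l - 1)
    have h3 := qbin_rec hq0 hq1 m l
    have hne : 1 - (q ^ 2) ^ l ≠ 0 := by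
      obtain ⟨k, rfl⟩ : ∃ k : ℕ, l = (k + 1 : ℕ) := ⟨(l - 1).toNat, by omega⟩
      rw [zpow_natCast]; exact (one_sub_pow_pos hq0 hq1 k).ne'
    have h4 : (q ^ 2) ^ (((m + 1 : ℕ) : ℤ) + l - 1) = (q ^ 2) ^ m * (q ^ 2) ^ l := by
      rw [← zpow_natCast (q ^ 2) m, ← zpow_add₀ (by positivity)]; congr 1; push_cast; ring
    have h5 : (m : ℤ) + (l - 1) = m + l - 1 := by ring
    rw [h4] at h1
    rw [h5] at h2
    apply mul_left_cancel₀ hne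
    linear_combination h1 + (q ^ 2) ^ l * h2 - (q ^ 2) ^ l * h3

/-! ### Closed form of the kernels -/

theorem shiftL_apply (q : ℝ) (K : Ker) (a b c d : ℕ) : shiftL q K a b c d =
    if b = 0 then 0 else (1 - (q : ℂ) ^ (2 * b)) * if c = 0 then 0 else K a (b - 1) (c - 1) d :=
  rfl

theorem shiftR_apply (q : ℝ) (K : Ker) (a b c d : ℕ) : shiftR q K a b c d =
    if a = 0 then 0 else if d = 0 then 0 else
      (1 - (q : ℂ) ^ (2 * d)) * K (a - 1) b c (d - 1) :=
  rfl

theorem shiftL_sub (q : ℝ) (K K' : Ker) : shiftL q (K - K') = shiftL q K - shiftL q K' := by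
  funext a b c d
  simp only [shiftL_apply, Pi.sub_apply]
  split_ifs <;> ring

theorem shiftR_sub (q : ℝ) (K K' : Ker) : shiftR q (K - K') = shiftR q K - shiftR q K' := by
  funext a b c d
  simp only [shiftR_apply, Pi.sub_apply]
  split_ifs <;> ring

theorem shiftR_smul (q : ℝ) (t : ℂ) (K : Ker) : shiftR q (t • K) = t • shiftR q K := by
  funext a b c d
  simp only [shiftR_apply, Pi.smul_apply, smul_eq_mul]
  split_ifs <;> ring

theorem shiftL_iterate_sub (q : ℝ) (k : ℕ) (K K' : Ker) :
    (shiftL q)^[k] (K - K') = (shiftL q)^[k] K - (shiftL q)^[k] K' := by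
  induction k generalizing K K' with
  | zero => rfl
  | succ k ih => rw [Function.iterate_succ_apply, shiftL_sub, ih]; rfl

theorem shiftR_iterate_sub_smul (q : ℝ) (k : ℕ) (t : ℂ) (K K' : Ker) :
    (shiftR q)^[k] (K - t • K') = (shiftR q)^[k] K - t • (shiftR q)^[k] K' := by
  induction k generalizing K K' with
  | zero => rfl
  | succ k ih => rw [Function.iterate_succ_apply, shiftR_sub, shiftR_smul, ih]; rfl

theorem shiftL_iterate_eq_zero (q : ℝ) (k : ℕ) (K : Ker) (a b c d : ℕ) (h : c < k) :
    (shiftL q)^[k] K a b c d = 0 := by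
  induction k generalizing b c with
  | zero => omega
  | succ k ih =>
    rw [Function.iterate_succ_apply', shiftL_apply]
    split_ifs
    · rfl
    · simp
    · rw [ih _ _ (by omega), mul_zero]

theorem shiftR_iterate_eq_zero (q : ℝ) (k : ℕ) (K : Ker) (a b c d : ℕ) (h : d < k) :
    (shiftR q)^[k] K a b c d = 0 := by
  induction k generalizing a d with
  | zero => omega
  | succ k ih =>
    rw [Function.iterate_succ_apply', shiftR_apply]
    split_ifs
    · rfl
    · rfl
    · rw [ih _ _ (by omega), mul_zero]

/-- With `K = X - shiftL q X` the truncated Neumann series telescopes to `X` minus a remainder. The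
remainder has no entry here, since each shift lowers the index `c` by one and `c + 1` shifts have
been applied. A closed form is therefore verified by one linear equation. -/
theorem geomL_eq_of_resolvent {q : ℝ} {K X : Ker} (h : X = K + shiftL q X) : geomL q K = X := by
  have hK : K = X - shiftL q X := eq_sub_of_add_eq h.symm
  funext a b c d
  have h1 : ∀ k, (shiftL q)^[k] K a b c d
      = (shiftL q)^[k] X a b c d - (shiftL q)^[k + 1] X a b c d := by
    intro k
    conv_lhs => rw [hK]
    rw [shiftL_iterate_sub]; rfl
  simp only [geomL, h1]
  rw [Finset.sum_range_sub', shiftL_iterate_eq_zero q (c + 1) X a b c d (by omega)]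
  simp

theorem geomR_eq_of_resolvent {q : ℝ} {t : ℂ} {K X : Ker} (h : X = K + t • shiftR q X) :
    geomR q t K = X := by
  have hK : K = X - t • shiftR q X := eq_sub_of_add_eq h.symm
  funext a b c d
  have h1 : ∀ k, t ^ k * (shiftR q)^[k] K a b c d
      = t ^ k * (shiftR q)^[k] X a b c d - t ^ (k + 1) * (shiftR q)^[k + 1] X a b c d := by
    intro k
    conv_lhs => rw [hK]
    rw [shiftR_iterate_sub_smul]
    simp only [Pi.sub_apply, Pi.smul_apply, smul_eq_mul, Function.iterate_succ_apply]
    ring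
  simp only [geomR, h1]
  rw [Finset.sum_range_sub' (fun k => t ^ k * (shiftR q)^[k] X a b c d),
    shiftR_iterate_eq_zero q (d + 1) X a b c d (by omega)]
  simp

/-- The entries of `{(y (1 - z ζ*)⁻¹)^m}`. -/
def kerR (q : ℝ) (m : ℕ) (a b c d : ℕ) : ℝ :=
  if a + c = b + d then (q ^ 2) ^ (b * m) * qbin q m ((a : ℤ) - b) * poch q d * (poch q c)⁻¹ else 0

/-- The resolvent equation satisfied by `kerR q (m + 1)` with source `y · kerR q m` is the
`q`-Pascal rule in the index `a - b`. -/
theorem factorR_iterate_oneK {q : ℝ} (hq0 : 0 < q) (hq1 : q < 1) (m : ℕ) :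
    (factorR q)^[m] oneK = fun a b c d => ((kerR q m a b c d : ℝ) : ℂ) := by
  induction m with
  | zero =>
    funext a b c d
    simp only [Function.iterate_zero, id_eq, oneK, one, kerR, qbin_zero]
    by_cases hab : a = b
    · subst hab
      by_cases hcd : c = d
      · subst hcd; simp [(poch_pos hq0 hq1 c).ne']
      · simp [hcd]
    · have : (a : ℤ) - b ≠ 0 := by omega
      simp [hab, this]
  | succ m ih =>
    rw [Function.iterate_succ_apply', ih]
    apply geomR_eq_of_resolvent
    funext a b c d
    rw [Pi.add_apply, Pi.add_apply, Pi.add_apply, Pi.add_apply, one_smul, shiftR_apply]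
    have h0 : inZ (yL q 1) (fun a b c d => ((kerR q m a b c d : ℝ) : ℂ)) a b c d
        = (((q ^ 2) ^ a * kerR q m a b c d : ℝ) : ℂ) := by
      simp only [inZ, yL]
      have : (2 * 1 * (a : ℤ)) = ((2 * a : ℕ) : ℤ) := by push_cast; ring
      rw [this, zpow_natCast, pow_mul]; push_cast; ring
    rw [h0]
    have hp : a + c = b + d → kerR q (m + 1) a b c d
        = (q ^ 2) ^ a * kerR q m a b c d
          + (q ^ 2) ^ (b * (m + 1)) * qbin q (m + 1) ((a : ℤ) - b - 1) * poch q d * (poch q c)⁻¹ := by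
      intro h
      have e : (q ^ 2) ^ (b * (m + 1)) * (q ^ 2) ^ ((a : ℤ) - b) = (q ^ 2) ^ a * (q ^ 2) ^ (b * m) := by
        have hq2 : q ^ 2 ≠ 0 := by positivity
        rw [← zpow_natCast (q ^ 2) (b * (m + 1)), ← zpow_natCast (q ^ 2) a,
          ← zpow_natCast (q ^ 2) (b * m), ← zpow_add₀ hq2, ← zpow_add₀ hq2]
        congr 1; push_cast; ring
      simp only [kerR, h, if_true]
      rw [qbin_pascal hq0 hq1 m]
      linear_combination (qbin q m ((a : ℤ) - b) * poch q d * (poch q c)⁻¹) * e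
    by_cases h : a + c = b + d
    · rw [hp h]
      split_ifs with ha hd
      · rw [qbin_of_neg q _ (by omega)]; simp
      · rw [qbin_of_neg q _ (by omega)]; simp
      · obtain ⟨a, rfl⟩ := Nat.exists_eq_add_one_of_ne_zero ha
        obtain ⟨d, rfl⟩ := Nat.exists_eq_add_one_of_ne_zero hd
        have h' : a + c = b + d := by omega
        have e1 : ((a + 1 : ℕ) : ℤ) - b - 1 = a - b := by push_cast; ring
        have e2 : kerR q (m + 1) (a + 1 - 1) b c (d + 1 - 1)
          = (q ^ 2) ^ (b * (m + 1)) * qbin q (m + 1) ((a : ℤ) - b) * poch q d * (poch q c)⁻¹ := by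
          simp only [kerR, Nat.add_sub_cancel, h', if_true]
        rw [e1, e2, poch_succ, pow_mul (q : ℂ)]
        push_cast
        ring
    · have h' : ∀ m, kerR q m a b c d = 0 := fun m => by simp [kerR, h]
      rw [h', h']
      split_ifs with ha hd
      · simp
      · simp
      · have : ¬ (a - 1 + c = b + (d - 1)) := by omega
        simp [kerR, this]

/-- The entries of `{((1 - ζ ζ*) (1 - z* ζ)⁻¹)^p K}`. -/
def kerL (q : ℝ) (p : ℕ) (K : Ker) : Ker := fun a b c d =>
  ∑ l ∈ Finset.range (c + 1), if l ≤ b then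
    (((q ^ 2) ^ ((c - l) * p + l) * qbin q p l * (poch q b * (poch q (b - l))⁻¹) : ℝ) : ℂ)
      * K a (b - l) (c - l) d else 0

/-- The entries of `{(1 - z* ζ)⁻¹ ((1 - ζ ζ*) (1 - z* ζ)⁻¹)^p K}`. -/
def kerL' (q : ℝ) (p : ℕ) (K : Ker) : Ker := fun a b c d =>
  ∑ l ∈ Finset.range (c + 1), if l ≤ b then
    (((q ^ 2) ^ ((c - l) * p) * qbin q (p + 1) l * (poch q b * (poch q (b - l))⁻¹) : ℝ) : ℂ)
      * K a (b - l) (c - l) d else 0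

theorem kerL'_resolvent {q : ℝ} (hq0 : 0 < q) (hq1 : q < 1) (p : ℕ) (K : Ker) :
    kerL' q p K = kerL q p K + shiftL q (kerL' q p K) := by
  funext a b c d
  rw [Pi.add_apply, Pi.add_apply, Pi.add_apply, Pi.add_apply, shiftL_apply]
  rcases c with _ | c
  · simp [kerL, kerL', qbin_at_zero]
  rcases b with _ | b
  · rw [kerL, kerL', Finset.sum_range_succ', Finset.sum_range_succ']
    simp [qbin_at_zero]
  rw [kerL, kerL', Finset.sum_range_succ' _ (c + 1), Finset.sum_range_succ' _ (c + 1)]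
  simp only [Nat.add_sub_cancel, if_neg (Nat.succ_ne_zero _), Nat.add_sub_add_right, kerL',
    Nat.add_le_add_iff_right]
  rw [Finset.mul_sum]
  simp only [Nat.cast_zero, qbin_at_zero]
  rw [add_right_comm, ← Finset.sum_add_distrib]
  congr 1
  · apply Finset.sum_congr rfl
    intro l _
    split_ifs
    · have h1 := qbin_pascal hq0 hq1 p ((l + 1 : ℕ) : ℤ)
      have e1 : ((l + 1 : ℕ) : ℤ) - 1 = l := by push_cast; ring
      rw [e1, zpow_natCast] at h1
      rw [h1, poch_succ, pow_mul (q : ℂ)]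
      push_cast
      ring
    · simp

theorem factorL_iterate {q : ℝ} (hq0 : 0 < q) (hq1 : q < 1) (p : ℕ) (K : Ker) :
    (factorL q)^[p] K = kerL q p K := by
  induction p with
  | zero =>
    funext a b c d
    rw [kerL, Finset.sum_range_succ', Finset.sum_eq_zero]
    · simp [qbin_zero, (poch_pos hq0 hq1 b).ne']
    · intro l _
      have : ((l + 1 : ℕ) : ℤ) ≠ 0 := by omega
      rw [qbin_zero, if_neg this]
      simp
  | succ p ih =>
    rw [Function.iterate_succ_apply', ih, factorL, geomL_eq_of_resolvent (kerL'_resolvent hq0 hq1 p K)]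
    funext a b c d
    simp only [inZeta, yL, kerL, kerL', Finset.mul_sum]
    apply Finset.sum_congr rfl
    intro l hl
    have hl : l ≤ c := by simpa [Nat.lt_succ_iff] using hl
    split_ifs
    -- The factor `y` contributes `t^c`, and `(c - l) p + c = (c - l) (p + 1) + l`.
    · obtain ⟨k, rfl⟩ := Nat.exists_eq_add_of_le hl
      have : (2 * 1 * ((l + k : ℕ) : ℤ)) = ((2 * (l + k) : ℕ) : ℤ) := by push_cast; ring
      rw [this, zpow_natCast, pow_mul, Nat.add_sub_cancel_left]
      push_cast
      ring
    · simp

/-- The summands of the entries of `G_m`. -/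
def termG (q : ℝ) (m : ℕ) (a b c : ℤ) (l : ℤ) : ℝ :=
  (q ^ 2) ^ (m * (b - l + (c - l)) + l) * qbin q m l * qbin q m (a - b + l)
    * rpoch q (b - l) * rpoch q (c - l)

/-- The entries of `G_m`, up to normalization. -/
def sumG (q : ℝ) (m : ℕ) (a b : ℤ) (c : ℕ) : ℝ :=
  ∑ l ∈ Finset.range (c + 1), termG q m a b c l

theorem greenTerm_eq {q : ℝ} (hq0 : 0 < q) (hq1 : q < 1) (m a b c d : ℕ) :
    greenTerm q m a b c d =
      ((if a + c = b + d then poch q b * poch q d * sumG q m a b c else 0 : ℝ) : ℂ) := by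
  rw [greenTerm, factorR_iterate_oneK hq0 hq1, factorL_iterate hq0 hq1, kerL]
  split_ifs with h
  · rw [sumG, Finset.mul_sum, Complex.ofReal_sum]
    apply Finset.sum_congr rfl
    intro l hl
    have hl : l ≤ c := by simpa [Nat.lt_succ_iff] using hl
    split_ifs with hb
    · obtain ⟨j, rfl⟩ := Nat.exists_eq_add_of_le hl
      obtain ⟨i, rfl⟩ := Nat.exists_eq_add_of_le hb
      rw [Nat.add_sub_cancel_left, Nat.add_sub_cancel_left, kerR, if_pos (by omega), termG]
      have e1 : ((l + i : ℕ) : ℤ) - l = i := by push_cast; ring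
      have e2 : ((l + j : ℕ) : ℤ) - l = j := by push_cast; ring
      have e3 : (a : ℤ) - ((l + i : ℕ) : ℤ) + l = a - i := by push_cast; ring
      have e4 : (m : ℤ) * ((i : ℤ) + j) + l = (m * (i + j) + l : ℕ) := by push_cast; ring
      rw [e1, e2, e3, e4, zpow_natCast, rpoch_natCast, rpoch_natCast, ← Complex.ofReal_mul]
      congr 1
      ring
    · rw [termG, rpoch_of_neg q (n := (b : ℤ) - l) (by omega)]
      simp
  · rw [Finset.sum_eq_zero]
    · simp
    intro l hl
    have hl : l ≤ c := by simpa [Nat.lt_succ_iff] using hl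
    split_ifs
    · rw [kerR, if_neg (by omega)]; simp
    · rfl

/-! ### The Laplacian of the Green function -/

/-- The telescoping certificate for the action of the Laplacian on `G_m`. -/
def certG (q : ℝ) (m : ℕ) (a b c : ℤ) (l : ℤ) : ℝ :=
  -((q ^ 2) ^ (m + 1 + (b - l) + (m * (b - l + (c - l)) + l))) *
    ((1 - (q ^ 2) ^ l) * qbin q m l) * ((1 - (q ^ 2) ^ (a - b + l)) * qbin q m (a - b + l))
    * rpoch q (b - l + 1) * rpoch q (c - l)

/-- A creative-telescoping identity: the relation between `□ G_m`, `G_m` and `G_{m+1}` fails for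
single summands only by a difference in `l`. After dividing by the common `q`-factorials it is a
polynomial identity in the powers of `t`. -/
theorem termG_laplace {q : ℝ} (hq0 : 0 < q) (hq1 : q < 1) (m : ℕ) (a b c l : ℤ) :
    (1 - (q ^ 2) ^ (a + 1)) *
        ((1 - (q ^ 2) ^ (b + 1)) * termG q m (a + 1) (b + 1) c l - termG q m a b c l)
      - q ^ 2 * ((1 - (q ^ 2) ^ b) * termG q m a b c l - termG q m (a - 1) (b - 1) c l)
      - q ^ 2 * ((q ^ 2) ^ m)⁻¹ * ((1 - (q ^ 2) ^ m) * (1 - (q ^ 2) ^ m * (q ^ 2)⁻¹)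
          * termG q m a b c l - (1 - (q ^ 2) ^ m) ^ 2 * termG q (m + 1) a b c l)
      = certG q m a b c (l + 1) - certG q m a b c l := by
  have ht : q ^ 2 ≠ 0 := by positivity
  have hP1 : rpoch q (b - l) = (1 - q ^ 2 * (q ^ 2) ^ (b - l)) * rpoch q (b - l + 1) := by
    have := rpoch_sub_one hq0 hq1 (b - l + 1)
    rwa [add_sub_cancel_right, zpow_add₀ ht, zpow_one, mul_comm _ (q ^ 2)] at this
  have hP0 : rpoch q (b - l - 1) = (1 - (q ^ 2) ^ (b - l)) * rpoch q (b - l) :=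
    rpoch_sub_one hq0 hq1 _
  have hJ : rpoch q (c - l - 1) = (1 - (q ^ 2) ^ (c - l)) * rpoch q (c - l) :=
    rpoch_sub_one hq0 hq1 _
  have hQl : (1 - (q ^ 2) ^ (l + 1)) * qbin q m (l + 1)
      = (1 - (q ^ 2) ^ m * (q ^ 2) ^ l) * qbin q m l := by
    have := qbin_rec hq0 hq1 m (l + 1)
    rwa [show (m : ℤ) + (l + 1) - 1 = m + l by ring, add_sub_cancel_right, zpow_add₀ ht (m : ℤ),
      zpow_natCast] at this
  have hQr : (1 - (q ^ 2) ^ (a - b + (l + 1))) * qbin q m (a - b + (l + 1))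
      = (1 - (q ^ 2) ^ m * (q ^ 2) ^ (a - b + l)) * qbin q m (a - b + l) := by
    have := qbin_rec hq0 hq1 m (a - b + (l + 1))
    rwa [show (m : ℤ) + (a - b + (l + 1)) - 1 = m + (a - b + l) by ring,
      show a - b + (l + 1) - 1 = a - b + l by ring, zpow_add₀ ht (m : ℤ), zpow_natCast] at this
  have hSl : (1 - (q ^ 2) ^ m) * qbin q (m + 1) l
      = (1 - (q ^ 2) ^ m * (q ^ 2) ^ l) * qbin q m l := by
    rw [qbin_succ, zpow_add₀ ht, zpow_natCast]
  have hSr : (1 - (q ^ 2) ^ m) * qbin q (m + 1) (a - b + l)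
      = (1 - (q ^ 2) ^ m * (q ^ 2) ^ (a - b + l)) * qbin q m (a - b + l) := by
    rw [qbin_succ, zpow_add₀ ht, zpow_natCast]
  have ea : (q ^ 2) ^ (a + 1) = q ^ 2 * (q ^ 2) ^ (b - l) * (q ^ 2) ^ (a - b + l) := by
    conv_rhs => rw [← zpow_one (q ^ 2)]
    rw [zpow_one, ← zpow_one_add₀ ht, ← zpow_add₀ ht]; congr 1; ring
  have eb : (q ^ 2) ^ b = (q ^ 2) ^ (b - l) * (q ^ 2) ^ l := by
    rw [← zpow_add₀ ht]; congr 1; ring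
  have eb1 : (q ^ 2) ^ (b + 1) = q ^ 2 * (q ^ 2) ^ (b - l) * (q ^ 2) ^ l := by
    rw [zpow_add_one₀ ht, eb]; ring
  have w0 : (q ^ 2) ^ ((m : ℤ) * (b - l + (c - l)) + l)
      = (q ^ 2) ^ ((m : ℤ) * (b - l + (c - l))) * (q ^ 2) ^ l := zpow_add₀ ht _ _
  have w1 : (q ^ 2) ^ ((m : ℤ) * (b + 1 - l + (c - l)) + l)
      = (q ^ 2) ^ ((m : ℤ) * (b - l + (c - l))) * (q ^ 2) ^ l * (q ^ 2) ^ m := by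
    rw [← zpow_natCast (q ^ 2) m, ← zpow_add₀ ht, ← zpow_add₀ ht]; congr 1; ring
  have w2 : (q ^ 2) ^ ((m : ℤ) * (b - 1 - l + (c - l)) + l)
      = (q ^ 2) ^ ((m : ℤ) * (b - l + (c - l))) * (q ^ 2) ^ l * ((q ^ 2) ^ m)⁻¹ := by
    rw [← zpow_natCast (q ^ 2) m, ← zpow_neg, ← zpow_add₀ ht, ← zpow_add₀ ht]; congr 1; ring
  have w3 : (q ^ 2) ^ (((m + 1 : ℕ) : ℤ) * (b - l + (c - l)) + l)
      = (q ^ 2) ^ ((m : ℤ) * (b - l + (c - l))) * (q ^ 2) ^ l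
        * (q ^ 2) ^ (b - l) * (q ^ 2) ^ (c - l) := by
    rw [← zpow_add₀ ht, ← zpow_add₀ ht, ← zpow_add₀ ht]; congr 1; push_cast; ring
  have w4 : (q ^ 2) ^ ((m : ℤ) + 1 + (b - l) + (m * (b - l + (c - l)) + l))
      = (q ^ 2) ^ ((m : ℤ) * (b - l + (c - l))) * (q ^ 2) ^ l * (q ^ 2) ^ m * q ^ 2
        * (q ^ 2) ^ (b - l) := by
    rw [← zpow_natCast (q ^ 2) m, ← zpow_add₀ ht, ← zpow_add₀ ht, ← zpow_add_one₀ ht,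
      ← zpow_add₀ ht]
    congr 1; ring
  have w5 : (q ^ 2) ^ ((m : ℤ) + 1 + (b - (l + 1)) + (m * (b - (l + 1) + (c - (l + 1))) + (l + 1)))
      = (q ^ 2) ^ ((m : ℤ) * (b - l + (c - l))) * (q ^ 2) ^ l * ((q ^ 2) ^ m)⁻¹ * q ^ 2
        * (q ^ 2) ^ (b - l) := by
    rw [← zpow_natCast (q ^ 2) m, ← zpow_neg, ← zpow_add₀ ht, ← zpow_add₀ ht, ← zpow_add_one₀ ht,
      ← zpow_add₀ ht]
    congr 1; ring
  simp only [termG, certG]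
  rw [w0, w1, w2, w3, w4, w5, ea, eb, eb1, hQl, hQr,
    show a + 1 - (b + 1) + l = a - b + l by ring, show a - 1 - (b - 1) + l = a - b + l by ring,
    show b - 1 - l = b - l - 1 by ring, show b + 1 - l = b - l + 1 by ring,
    show b - (l + 1) + 1 = b - l by ring, show c - (l + 1) = c - l - 1 by ring, hP0, hP1, hJ]
  have hM : (q ^ 2) ^ m * ((q ^ 2) ^ m)⁻¹ = 1 := mul_inv_cancel₀ (by positivity)
  have hT : q ^ 2 * (q ^ 2)⁻¹ = 1 := mul_inv_cancel₀ ht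
  -- All shifted quantities are now expressed through `p`, `p'`, `u`, `v` and `u'`, `v'`, so the
  -- powers of `t` may be treated as indeterminates.
  generalize (q ^ 2) ^ ((m : ℤ) * (b - l + (c - l))) = W at *
  generalize (q ^ 2) ^ (b - l) = I at *
  generalize (q ^ 2) ^ (c - l) = J at *
  generalize (q ^ 2) ^ (a - b + l) = R at *
  generalize (q ^ 2) ^ l = X at *
  generalize (q ^ 2) ^ m = M at *
  generalize M⁻¹ = N at *
  generalize rpoch q (b - l + 1) = p at *
  generalize rpoch q (c - l) = p' at *
  generalize (q ^ 2)⁻¹ = s at *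
  generalize q ^ 2 = t at *
  generalize qbin q m (a - b + l) = v at *
  generalize qbin q m l = u at *
  generalize qbin q (m + 1) (a - b + l) = v' at *
  generalize qbin q (m + 1) l = u' at *
  -- The binomials for `m + 1` occur only as `(1 - M)² u' v'`, so no division by `1 - M`, which is
  -- zero for `m = 0`, is needed.
  have huv : (1 - M) ^ 2 * (u' * v') = (1 - M * X) * u * ((1 - M * R) * v) := by
    rw [← hSl, ← hSr]; ring
  linear_combination (t * N * W * X * I * J * (1 - t * I) * p * p') * huv
    + (X * W * u * v * p * p' * (1 - t * I) * (t + 1 - M - t * I * R + t * I * R * X * M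
      - t * I * X)) * hM
    + (N * M * X * W * u * v * p * p' * (1 - M) * (1 - t * I)) * hT

/-- The entries of `G_m`. -/
def greenR (q : ℝ) (m a b c d : ℕ) : ℝ :=
  if a + c = b + d then poch q b * poch q d * sumG q m a b c else 0

theorem sumG_laplace {q : ℝ} (hq0 : 0 < q) (hq1 : q < 1) (m : ℕ) (a b : ℤ) (c : ℕ) :
    (1 - (q ^ 2) ^ (a + 1)) *
        ((1 - (q ^ 2) ^ (b + 1)) * sumG q m (a + 1) (b + 1) c - sumG q m a b c)
      - q ^ 2 * ((1 - (q ^ 2) ^ b) * sumG q m a b c - sumG q m (a - 1) (b - 1) c)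
      = q ^ 2 * ((q ^ 2) ^ m)⁻¹ * ((1 - (q ^ 2) ^ m) * (1 - (q ^ 2) ^ m * (q ^ 2)⁻¹)
          * sumG q m a b c - (1 - (q ^ 2) ^ m) ^ 2 * sumG q (m + 1) a b c) := by
  have h := Finset.sum_congr rfl fun l (_ : l ∈ Finset.range (c + 1)) =>
    termG_laplace hq0 hq1 m a b c l
  have h2 := Finset.sum_range_sub (fun l : ℕ => certG q m a b c l) (c + 1)
  -- The certificate vanishes at `l = 0` through `1 - t^l` and at `l = c + 1` through the reciprocal
  -- factorial at `-1`.
  have hc0 : certG q m a b c ((0 : ℕ) : ℤ) = 0 := by simp [certG]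
  have hc1 : certG q m a b c ((c + 1 : ℕ) : ℤ) = 0 := by
    rw [certG, rpoch_of_neg q (n := (c : ℤ) - ((c + 1 : ℕ) : ℤ)) (by omega), mul_zero]
  rw [hc0, hc1, sub_zero] at h2
  push_cast at h2
  rw [h2] at h
  simp only [Finset.sum_sub_distrib, ← Finset.mul_sum] at h
  simp only [sumG]
  linear_combination h

theorem sumG_of_neg (q : ℝ) (m : ℕ) (a b : ℤ) (c : ℕ) (h : a < 0 ∨ b < 0) :
    sumG q m a b c = 0 := by
  apply Finset.sum_eq_zero
  intro l _
  rw [termG]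
  rcases lt_or_ge (b - (l : ℤ)) 0 with hb | hb
  · rw [rpoch_of_neg q hb]; ring
  · rw [qbin_of_neg q m (l := a - b + l) (by omega)]; ring

/-- `f ↦ (1 - q²)² □ f`. -/
def lap (q : ℝ) (w : Distr) : Distr := fun a b =>
  (1 - ((q : ℂ) ^ 2) ^ (a + 1)) * (w (a + 1) (b + 1) - w a b)
    - (q : ℂ) ^ 2 * (1 - ((q : ℂ) ^ 2) ^ b) * (w a b - zL w a (b - 1))

theorem lap_greenR {q : ℝ} (hq0 : 0 < q) (hq1 : q < 1) (m a b c d : ℕ) :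
    lap q (fun a b => ((greenR q (m + 1) a b c d : ℝ) : ℂ)) a b
      = (((q ^ 2) ^ m)⁻¹ * ((1 - (q ^ 2) ^ (m + 1)) * ((1 - (q ^ 2) ^ m) * greenR q (m + 1) a b c d
          - (1 - (q ^ 2) ^ (m + 1)) * greenR q (m + 2) a b c d)) : ℝ) := by
  have hq2 : q ^ 2 ≠ 0 := by positivity
  have hcast : lap q (fun a b => ((greenR q (m + 1) a b c d : ℝ) : ℂ)) a b
      = (((1 - (q ^ 2) ^ (a + 1)) * (greenR q (m + 1) (a + 1) (b + 1) c d
          - greenR q (m + 1) a b c d) - q ^ 2 * (1 - (q ^ 2) ^ b) * (greenR q (m + 1) a b c d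
          - if a = 0 then 0 else greenR q (m + 1) (a - 1) (b - 1) c d) : ℝ) : ℂ) := by
    simp only [lap, zL]
    split_ifs <;> push_cast <;> rfl
  rw [hcast]
  congr 1
  by_cases h : a + c = b + d
  · have hb : (1 - (q ^ 2) ^ b) * (if a = 0 then 0 else greenR q (m + 1) (a - 1) (b - 1) c d)
        = poch q b * poch q d * sumG q (m + 1) ((a : ℤ) - 1) ((b : ℤ) - 1) c := by
      rcases b with _ | b
      · rw [sumG_of_neg q _ _ _ _ (Or.inr (by simp))]; simp
      rcases a with _ | a
      · rw [sumG_of_neg q _ _ _ _ (Or.inl (by simp))]; simp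
      · rw [if_neg (Nat.succ_ne_zero a), Nat.add_sub_cancel, Nat.add_sub_cancel, greenR,
          if_pos (by omega), poch_succ]
        have e1 : ((a + 1 : ℕ) : ℤ) - 1 = a := by push_cast; ring
        have e2 : ((b + 1 : ℕ) : ℤ) - 1 = b := by push_cast; ring
        rw [e1, e2]; ring
    have ha : greenR q (m + 1) (a + 1) (b + 1) c d = (1 - (q ^ 2) ^ (b + 1)) * (poch q b * poch q d
        * sumG q (m + 1) ((a : ℤ) + 1) ((b : ℤ) + 1) c) := by
      rw [greenR, if_pos (by omega), poch_succ]; push_cast; ring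
    have h0 : ∀ k, greenR q k a b c d = poch q b * poch q d * sumG q k a b c := fun k => by
      rw [greenR, if_pos h]
    have key := sumG_laplace hq0 hq1 (m + 1) a b c
    have e1 : (q ^ 2) ^ ((a : ℤ) + 1) = (q ^ 2) ^ (a + 1) := by
      rw [← zpow_natCast]; push_cast; rfl
    have e2 : (q ^ 2) ^ ((b : ℤ) + 1) = (q ^ 2) ^ (b + 1) := by
      rw [← zpow_natCast]; push_cast; rfl
    have e3 : q ^ 2 * ((q ^ 2) ^ (m + 1))⁻¹ = ((q ^ 2) ^ m)⁻¹ := by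
      rw [pow_succ (q ^ 2) m, mul_inv, mul_comm, mul_assoc, inv_mul_cancel₀ hq2, mul_one]
    have e4 : (q ^ 2) ^ (m + 1) * (q ^ 2)⁻¹ = (q ^ 2) ^ m := by
      rw [pow_succ]; field_simp
    rw [e1, e2, zpow_natCast, e3, e4] at key
    rw [mul_sub (q ^ 2 * (1 - (q ^ 2) ^ b)), mul_assoc (q ^ 2) _ (ite _ _ _), hb, ha, h0, h0]
    linear_combination (poch q b * poch q d) * key
  · have h0 : ∀ k, greenR q k a b c d = 0 := fun k => by rw [greenR, if_neg h]
    have h1 : greenR q (m + 1) (a + 1) (b + 1) c d = 0 := by rw [greenR, if_neg (by omega)]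
    rw [h0, h0, h1]
    split_ifs with ha
    · simp
    · rcases b with _ | b
      · simp
      · have : greenR q (m + 1) (a - 1) (b + 1 - 1) c d = 0 := by rw [greenR, if_neg (by omega)]
        rw [this]; simp

/-! ### Bounds and limits of the kernels -/

theorem poch_le_one {q : ℝ} (hq0 : 0 < q) (hq1 : q < 1) (n : ℕ) : poch q n ≤ 1 := by
  induction n with
  | zero => simp [poch_zero]
  | succ n ih =>
    rw [poch_succ]
    have h1 := poch_pos hq0 hq1 n
    have h2 : 0 < (q ^ 2) ^ (n + 1) := by positivity
    nlinarith

theorem one_sub_sq_pos {q : ℝ} (hq0 : 0 < q) (hq1 : q < 1) : 0 < 1 - q ^ 2 := by nlinarith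

theorem one_sub_sq_le {q : ℝ} (hq0 : 0 < q) (hq1 : q < 1) (n : ℕ) :
    1 - q ^ 2 ≤ 1 - (q ^ 2) ^ (n + 1) := by
  have := pow_le_of_le_one (by positivity : 0 ≤ q ^ 2) (by nlinarith) (Nat.succ_ne_zero n)
  simp only [Nat.succ_eq_add_one] at this
  linarith

theorem poch_add_le {q : ℝ} (hq0 : 0 < q) (hq1 : q < 1) (n k : ℕ) :
    poch q (n + k) ≤ poch q n := by
  induction k with
  | zero => simp
  | succ k ih =>
    rw [← add_assoc, poch_succ]
    have h1 := poch_pos hq0 hq1 (n + k)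
    have h2 : 0 < (q ^ 2) ^ (n + k + 1) := by positivity
    nlinarith

theorem le_poch_add {q : ℝ} (hq0 : 0 < q) (hq1 : q < 1) (n k : ℕ) :
    poch q n * (1 - q ^ 2) ^ k ≤ poch q (n + k) := by
  induction k with
  | zero => simp
  | succ k ih =>
    rw [← add_assoc, poch_succ, pow_succ, ← mul_assoc]
    exact mul_le_mul ih (one_sub_sq_le hq0 hq1 _) (one_sub_sq_pos hq0 hq1).le
      (poch_pos hq0 hq1 _).le

theorem poch_div_le {q : ℝ} (hq0 : 0 < q) (hq1 : q < 1) {m n N : ℕ} (h : n ≤ m + N) :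
    poch q m / poch q n ≤ ((1 - q ^ 2)⁻¹) ^ N := by
  have h1 : poch q (m + N) ≤ poch q n := by
    obtain ⟨k, hk⟩ := Nat.exists_eq_add_of_le h
    rw [hk]; exact poch_add_le hq0 hq1 n k
  have h2 := le_poch_add hq0 hq1 m N
  have hs := one_sub_sq_pos hq0 hq1
  rw [div_le_iff₀ (poch_pos hq0 hq1 n), inv_pow, inv_mul_eq_div, le_div_iff₀ (by positivity)]
  exact h2.trans h1

theorem one_le_inv_one_sub {q : ℝ} (hq0 : 0 < q) (hq1 : q < 1) : 1 ≤ (1 - q ^ 2)⁻¹ := by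
  rw [one_le_inv₀ (one_sub_sq_pos hq0 hq1)]
  have : 0 < q ^ 2 := by positivity
  linarith

theorem rpoch_nonneg {q : ℝ} (hq0 : 0 < q) (hq1 : q < 1) (n : ℤ) : 0 ≤ rpoch q n := by
  rw [rpoch]
  split_ifs
  · exact le_rfl
  · exact (inv_pos.2 (poch_pos hq0 hq1 _)).le

theorem rpoch_le {q : ℝ} (hq0 : 0 < q) (hq1 : q < 1) {n : ℤ} {N : ℕ} (h : n ≤ N) :
    rpoch q n ≤ ((1 - q ^ 2)⁻¹) ^ N := by
  rcases lt_or_ge n 0 with hn | hn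
  · rw [rpoch_of_neg q hn]
    exact pow_nonneg (zero_le_one.trans (one_le_inv_one_sub hq0 hq1)) _
  · lift n to ℕ using hn
    have := poch_div_le hq0 hq1 (m := 0) (n := n) (N := N) (by omega)
    rwa [poch_zero, one_div, ← rpoch_natCast] at this

theorem poch_mul_rpoch_le {q : ℝ} (hq0 : 0 < q) (hq1 : q < 1) (b l : ℕ) :
    poch q b * rpoch q ((b : ℤ) - l) ≤ 1 := by
  rcases lt_or_ge ((b : ℤ) - l) 0 with hn | hn
  · rw [rpoch_of_neg q hn]; simp
  · obtain ⟨i, rfl⟩ : ∃ i, b = i + l := ⟨b - l, by omega⟩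
    have e : ((i + l : ℕ) : ℤ) - l = i := by push_cast; ring
    rw [e, rpoch_natCast, ← div_eq_mul_inv, div_le_one (poch_pos hq0 hq1 i)]
    exact poch_add_le hq0 hq1 i l

theorem qbin_nonneg {q : ℝ} (hq0 : 0 < q) (hq1 : q < 1) (m : ℕ) (l : ℤ) : 0 ≤ qbin q m l := by
  rw [qbin]
  split_ifs
  · exact le_rfl
  · apply Finset.prod_nonneg
    intro j _
    refine div_nonneg ?_ (one_sub_pow_pos hq0 hq1 j).le
    exact sub_nonneg.2 (pow_le_one₀ (by positivity) (by nlinarith))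

theorem qbin_le {q : ℝ} (hq0 : 0 < q) (hq1 : q < 1) (m : ℕ) {l : ℤ} {N : ℕ} (h : l ≤ N) :
    qbin q m l ≤ ((1 - q ^ 2)⁻¹) ^ N := by
  rcases lt_or_ge l 0 with hl | hl
  · rw [qbin_of_neg q m hl]
    exact pow_nonneg (zero_le_one.trans (one_le_inv_one_sub hq0 hq1)) _
  · lift l to ℕ using hl
    rw [qbin_natCast]
    calc _ ≤ ∏ _j ∈ Finset.range l, (1 - q ^ 2)⁻¹ := by
          apply Finset.prod_le_prod
          · intro j _
            refine div_nonneg ?_ (one_sub_pow_pos hq0 hq1 j).le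
            exact sub_nonneg.2 (pow_le_one₀ (by positivity) (by nlinarith))
          · intro j _
            rw [← one_div]
            refine div_le_div₀ zero_le_one ?_ (one_sub_sq_pos hq0 hq1) (one_sub_sq_le hq0 hq1 j)
            have : 0 < (q ^ 2) ^ (m + j) := by positivity
            linarith
      _ = ((1 - q ^ 2)⁻¹) ^ l := by simp
      _ ≤ _ := pow_le_pow_right₀ (one_le_inv_one_sub hq0 hq1) (by exact_mod_cast h)

theorem termG_nonneg {q : ℝ} (hq0 : 0 < q) (hq1 : q < 1) (m : ℕ) (a b c l : ℤ) :
    0 ≤ termG q m a b c l := by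
  rw [termG]
  have : 0 ≤ (q ^ 2) ^ (m * (b - l + (c - l)) + l) := by positivity
  have h1 := mul_nonneg this (qbin_nonneg hq0 hq1 m l)
  exact mul_nonneg (mul_nonneg (mul_nonneg h1 (qbin_nonneg hq0 hq1 m _))
    (rpoch_nonneg hq0 hq1 _)) (rpoch_nonneg hq0 hq1 _)

theorem greenR_nonneg {q : ℝ} (hq0 : 0 < q) (hq1 : q < 1) (m a b c d : ℕ) :
    0 ≤ greenR q m a b c d := by
  rw [greenR]
  split_ifs
  · exact mul_nonneg (mul_nonneg (poch_pos hq0 hq1 _).le (poch_pos hq0 hq1 _).le)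
      (Finset.sum_nonneg fun l _ => termG_nonneg hq0 hq1 _ _ _ _ _)
  · exact le_rfl

/-- For `m ≥ 1` and `l ≤ b` the exponent `m (b - l + c - l) + l` is at least `b`, which gives decay
in `b` uniform in `m`. The indices `l`, `a - b + l = d - c + l` and `c - l` stay below `N`; the
unbounded index `b - l` is controlled by pairing its factorial with that of `b`. -/
theorem termG_le {q : ℝ} (hq0 : 0 < q) (hq1 : q < 1) {m a b c d l N : ℕ} (h : a + c = b + d)
    (hm : 1 ≤ m) (hl : l ≤ c) (hc : c ≤ N) (hd : d ≤ N) :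
    poch q b * poch q d * termG q m a b c l
      ≤ (q ^ 2) ^ b * (((1 - q ^ 2)⁻¹) ^ N * ((1 - q ^ 2)⁻¹) ^ N * ((1 - q ^ 2)⁻¹) ^ N) := by
  have hD : 0 ≤ ((1 - q ^ 2)⁻¹) ^ N :=
    pow_nonneg (zero_le_one.trans (one_le_inv_one_sub hq0 hq1)) _
  rcases lt_or_ge b l with hb | hb
  · rw [termG, rpoch_of_neg q (n := (b : ℤ) - l) (by omega)]
    simp only [mul_zero, zero_mul]
    positivity
  · have hw : (q ^ 2) ^ ((m : ℤ) * ((b : ℤ) - l + ((c : ℤ) - l)) + l) ≤ (q ^ 2) ^ b := by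
      obtain ⟨i, rfl⟩ := Nat.exists_eq_add_of_le hb
      obtain ⟨j, rfl⟩ := Nat.exists_eq_add_of_le hl
      have e : (m : ℤ) * (((l + i : ℕ) : ℤ) - l + (((l + j : ℕ) : ℤ) - l)) + l
          = (m * (i + j) + l : ℕ) := by push_cast; ring
      rw [e, zpow_natCast]
      apply pow_le_pow_of_le_one (by positivity) (by nlinarith)
      nlinarith
    have h0 := poch_mul_rpoch_le hq0 hq1 b l
    have h1 := qbin_le hq0 hq1 m (l := (l : ℤ)) (N := N) (by omega)
    have h2 := qbin_le hq0 hq1 m (l := (a : ℤ) - b + l) (N := N) (by omega)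
    have h3 := rpoch_le hq0 hq1 (n := (c : ℤ) - l) (N := N) (by omega)
    have h4 := poch_le_one hq0 hq1 d
    have n0 := mul_nonneg (poch_pos hq0 hq1 b).le (rpoch_nonneg hq0 hq1 ((b : ℤ) - l))
    have n1 := qbin_nonneg hq0 hq1 m l
    have n2 := qbin_nonneg hq0 hq1 m ((a : ℤ) - b + l)
    have n3 := rpoch_nonneg hq0 hq1 ((c : ℤ) - l)
    have n4 := (poch_pos hq0 hq1 d).le
    calc poch q b * poch q d * termG q m a b c l
        = (poch q b * rpoch q ((b : ℤ) - l)) * poch q d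
          * ((q ^ 2) ^ ((m : ℤ) * ((b : ℤ) - l + ((c : ℤ) - l)) + l)
            * (qbin q m l * qbin q m ((a : ℤ) - b + l) * rpoch q ((c : ℤ) - l))) := by
          rw [termG]; ring
      _ ≤ 1 * 1 * ((q ^ 2) ^ b * (((1 - q ^ 2)⁻¹) ^ N * ((1 - q ^ 2)⁻¹) ^ N
            * ((1 - q ^ 2)⁻¹) ^ N)) := by
          gcongr
      _ = _ := by ring

/-- A bound for the kernels `G_m` near the diagonal. -/
def boundG (q : ℝ) (N : ℕ) : ℝ := (N + 1) * (((1 - q ^ 2)⁻¹) ^ N) ^ 3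

theorem boundG_nonneg {q : ℝ} (hq0 : 0 < q) (hq1 : q < 1) (N : ℕ) : 0 ≤ boundG q N := by
  have := one_le_inv_one_sub hq0 hq1
  rw [boundG]
  positivity

theorem greenR_le {q : ℝ} (hq0 : 0 < q) (hq1 : q < 1) {m a b c d N : ℕ}
    (hm : 1 ≤ m) (hc : c ≤ N) (hd : d ≤ N) :
    greenR q m a b c d ≤ boundG q N * (q ^ 2) ^ b := by
  have hD := boundG_nonneg hq0 hq1 N
  rw [greenR]
  split_ifs with h
  · rw [sumG, Finset.mul_sum]
    have hD' := one_le_inv_one_sub hq0 hq1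
    calc _ ≤ ∑ l ∈ Finset.range (c + 1), (q ^ 2) ^ b
          * (((1 - q ^ 2)⁻¹) ^ N * ((1 - q ^ 2)⁻¹) ^ N * ((1 - q ^ 2)⁻¹) ^ N) :=
          Finset.sum_le_sum fun l hl => termG_le hq0 hq1 h hm
            (by simpa [Nat.lt_succ_iff] using hl) hc hd
      _ = ((c : ℝ) + 1) * ((((1 - q ^ 2)⁻¹) ^ N) ^ 3 * (q ^ 2) ^ b) := by
          rw [Finset.sum_const, Finset.card_range, nsmul_eq_mul]; push_cast; ring
      _ ≤ ((N : ℝ) + 1) * ((((1 - q ^ 2)⁻¹) ^ N) ^ 3 * (q ^ 2) ^ b) := by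
          gcongr
      _ = _ := by rw [boundG]; ring
  · positivity

/-! ### The limit of the kernels as `m → ∞` -/

theorem tendsto_pow_sq {q : ℝ} (hq0 : 0 < q) (hq1 : q < 1) (k : ℕ) :
    Tendsto (fun m : ℕ => (q ^ 2) ^ (m + k)) atTop (𝓝 0) :=
  (tendsto_add_atTop_iff_nat k).2
    (tendsto_pow_atTop_nhds_zero_of_lt_one (by positivity) (by nlinarith))

theorem tendsto_qbin {q : ℝ} (hq0 : 0 < q) (hq1 : q < 1) (l : ℤ) :
    Tendsto (fun m => qbin q m l) atTop (𝓝 (rpoch q l)) := by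
  rcases lt_or_ge l 0 with hl | hl
  · simp only [rpoch_of_neg q hl, qbin_of_neg q _ hl, tendsto_const_nhds]
  · lift l to ℕ using hl
    simp only [qbin_natCast, rpoch_natCast]
    have : (poch q l)⁻¹ = ∏ j ∈ Finset.range l, (1 - 0) / (1 - (q ^ 2) ^ (j + 1)) := by
      rw [poch, ← Finset.prod_inv_distrib]
      exact Finset.prod_congr rfl fun j _ => by rw [sub_zero, one_div, pow_mul]
    rw [this]
    apply tendsto_finsetProd
    intro j _
    exact (tendsto_const_nhds.sub (tendsto_pow_sq hq0 hq1 j)).div_const _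

theorem tendsto_termG {q : ℝ} (hq0 : 0 < q) (hq1 : q < 1) {a b c l : ℕ} (hl : l ≤ c) :
    Tendsto (fun m => termG q m a b c l) atTop
      (𝓝 (if b = l ∧ c = l then (q ^ 2) ^ l * rpoch q l * rpoch q ((a : ℤ) - b + l) else 0)) := by
  have hq := (tendsto_qbin hq0 hq1 (l : ℤ)).mul (tendsto_qbin hq0 hq1 ((a : ℤ) - b + l))
  split_ifs with h
  · have := hq.const_mul ((q ^ 2) ^ l)
    rw [← mul_assoc] at this
    obtain ⟨rfl, rfl⟩ := h
    refine this.congr fun m => ?_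
    simp [termG, rpoch, poch_zero]
    ring
  · rcases lt_or_ge b l with hb | hb
    · simp only [termG, rpoch_of_neg q (n := (b : ℤ) - l) (by omega), mul_zero, zero_mul,
        tendsto_const_nhds]
    · have hw : Tendsto (fun m : ℕ => (q ^ 2) ^ ((m : ℤ) * ((b : ℤ) - l + ((c : ℤ) - l)) + l))
          atTop (𝓝 0) := by
        obtain ⟨i, rfl⟩ := Nat.exists_eq_add_of_le hb
        obtain ⟨j, rfl⟩ := Nat.exists_eq_add_of_le hl
        have e : ∀ m : ℕ, (q ^ 2) ^ ((m : ℤ) * (((l + i : ℕ) : ℤ) - l + (((l + j : ℕ) : ℤ) - l)) + l)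
            = ((q ^ 2) ^ (i + j)) ^ m * (q ^ 2) ^ l := by
          intro m
          rw [show (m : ℤ) * (((l + i : ℕ) : ℤ) - l + (((l + j : ℕ) : ℤ) - l)) + l
            = ((i + j) * m + l : ℕ) by push_cast; ring, zpow_natCast, pow_add, pow_mul]
        simp only [e]
        have h1 : (q ^ 2) ^ (i + j) < 1 :=
          pow_lt_one₀ (by positivity) (by nlinarith) (by omega)
        simpa using (tendsto_pow_atTop_nhds_zero_of_lt_one (by positivity) h1).mul_const
          ((q ^ 2) ^ l)
      have := ((hw.mul hq).mul_const (rpoch q ((b : ℤ) - l))).mul_const (rpoch q ((c : ℤ) - l))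
      simp only [zero_mul] at this
      refine this.congr fun m => ?_
      rw [termG]; ring

/-- The power `t^{m (b - l + c - l)}` kills every summand except `l = b = c`. There the limiting
binomials are reciprocal factorials that cancel the normalization and leave `t^c`: the kernel of the
identity operator for `dμ`, up to `1 - q²` and powers of `y`. -/
theorem tendsto_greenR {q : ℝ} (hq0 : 0 < q) (hq1 : q < 1) (a b c d : ℕ) :
    Tendsto (fun m => greenR q m a b c d) atTop
      (𝓝 (if a = d ∧ b = c then (q ^ 2) ^ c else 0)) := by
  by_cases h : a + c = b + d
  · simp only [greenR, h, if_true, sumG]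
    have hs := (tendsto_finsetSum (Finset.range (c + 1)) fun l hl =>
      tendsto_termG hq0 hq1 (a := a) (b := b) (c := c) (l := l)
        (by simpa [Nat.lt_succ_iff] using hl)).const_mul (poch q b * poch q d)
    convert hs using 2
    by_cases hbc : b = c
    · subst hbc
      have had : a = d := by omega
      subst had
      rw [Finset.sum_eq_single b]
      · have h1 := (poch_pos hq0 hq1 a).ne'
        have h2 := (poch_pos hq0 hq1 b).ne'
        simp only [and_self, if_true, rpoch_natCast, sub_add_cancel]
        field_simp
      · intro l _ hl
        rw [if_neg (by tauto)]
      · intro hb; simp at hb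
    · rw [if_neg (by tauto), Finset.sum_eq_zero, mul_zero]
      intro l _
      rw [if_neg (by omega)]
  · have : ¬ (a = d ∧ b = c) := by omega
    simp only [greenR, h, if_false, this, tendsto_const_nhds]

/-! ### The Green function -/

theorem greenSummand_eq {q : ℝ} (hq0 : 0 < q) (hq1 : q < 1) (m a b c d : ℕ) :
    greenSummand q m a b c d =
      ((-((1 - q ^ 2) * ((q ^ 2) ^ m / (1 - (q ^ 2) ^ (m + 1)))) * greenR q (m + 1) a b c d : ℝ) : ℂ)
    := by
  have h1 := (one_sub_pow_pos hq0 hq1 m).ne'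
  have h2 : -(((q : ℂ) ^ (-2 : ℤ) - 1) / ((q : ℂ) ^ (-2 * ((m : ℤ) + 1)) - 1))
      = ((-((1 - q ^ 2) * ((q ^ 2) ^ m / (1 - (q ^ 2) ^ (m + 1)))) : ℝ) : ℂ) := by
    have e1 : q ^ (-2 : ℤ) = (q ^ 2)⁻¹ := by rw [zpow_neg]; rfl
    have e2 : q ^ (-2 * ((m : ℤ) + 1)) = ((q ^ 2) ^ (m + 1))⁻¹ := by
      rw [← pow_mul, ← zpow_natCast, ← zpow_neg]; congr 1
    have e3 : -((q ^ (-2 : ℤ) - 1) / (q ^ (-2 * ((m : ℤ) + 1)) - 1))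
        = -((1 - q ^ 2) * ((q ^ 2) ^ m / (1 - (q ^ 2) ^ (m + 1)))) := by
      rw [e1, e2]
      have h3 : ((q ^ 2) ^ (m + 1))⁻¹ - 1 ≠ 0 := by
        have : 1 < ((q ^ 2) ^ (m + 1))⁻¹ :=
          (one_lt_inv₀ (by positivity)).2 (sub_pos.1 (one_sub_pow_pos hq0 hq1 m))
        linarith
      rw [neg_inj, ← mul_div_assoc, div_eq_div_iff h3 h1]
      field_simp
      ring
    rw [← e3]
    push_cast
    rfl
  rw [greenSummand, h2]
  simp only [Pi.smul_apply, smul_eq_mul]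
  rw [greenTerm_eq hq0 hq1, ← greenR]
  push_cast
  rfl

theorem norm_greenSummand_le {q : ℝ} (hq0 : 0 < q) (hq1 : q < 1) {m a b c d N : ℕ}
    (hc : c ≤ N) (hd : d ≤ N) :
    ‖greenSummand q m a b c d‖ ≤ (q ^ 2) ^ m * (boundG q N * (q ^ 2) ^ b) := by
  have h1 := one_sub_pow_pos hq0 hq1 m
  have h2 := one_sub_sq_pos hq0 hq1
  have h3 := one_sub_sq_le hq0 hq1 m
  have h4 := greenR_le hq0 hq1 (m := m + 1) (a := a) (b := b) (by omega) hc hd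
  have h5 := greenR_nonneg hq0 hq1 (m + 1) a b c d
  have h6 : (1 - q ^ 2) * ((q ^ 2) ^ m / (1 - (q ^ 2) ^ (m + 1))) ≤ (q ^ 2) ^ m := by
    rw [← mul_div_assoc, div_le_iff₀ h1, mul_comm]
    gcongr
  rw [greenSummand_eq hq0 hq1, Complex.norm_real, norm_mul, norm_neg, Real.norm_of_nonneg h5,
    Real.norm_of_nonneg (by positivity)]
  gcongr

theorem summable_pow_sq {q : ℝ} (hq0 : 0 < q) (hq1 : q < 1) :
    Summable fun m : ℕ => (q ^ 2) ^ m :=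
  summable_geometric_of_lt_one (by positivity) (by nlinarith)

theorem summable_greenSummand {q : ℝ} (hq0 : 0 < q) (hq1 : q < 1) (a b c d : ℕ) :
    Summable fun m => greenSummand q m a b c d :=
  Summable.of_norm_bounded ((summable_pow_sq hq0 hq1).mul_right _) fun _ =>
    norm_greenSummand_le hq0 hq1 (le_max_left c d) (le_max_right c d)

theorem hasSum_green {q : ℝ} (hq0 : 0 < q) (hq1 : q < 1) : HasSum (greenSummand q) (green q) := by
  simp only [Pi.hasSum]
  intro a b c d
  exact (summable_greenSummand hq0 hq1 a b c d).hasSum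

theorem norm_green_le {q : ℝ} (hq0 : 0 < q) (hq1 : q < 1) {a b c d N : ℕ}
    (hc : c ≤ N) (hd : d ≤ N) :
    ‖green q a b c d‖ ≤ (1 - q ^ 2)⁻¹ * (boundG q N * (q ^ 2) ^ b) := by
  refine tsum_of_norm_bounded ?_ fun m => norm_greenSummand_le hq0 hq1 hc hd
  exact (hasSum_geometric_of_lt_one (by positivity) (by nlinarith)).mul_right _

theorem green_eq_zero {q : ℝ} (hq0 : 0 < q) (hq1 : q < 1) {a b c d : ℕ} (h : a + c ≠ b + d) :
    green q a b c d = 0 := by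
  have : ∀ m, greenSummand q m a b c d = 0 := fun m => by
    rw [greenSummand_eq hq0 hq1, greenR, if_neg h]; simp
  simp [green, this]

theorem lap_green {q : ℝ} (hq0 : 0 < q) (hq1 : q < 1) (a b c d : ℕ) :
    lap q (fun a b => green q a b c d) a b
      = if a = d ∧ b = c then (1 - (q : ℂ) ^ 2) * ((q : ℂ) ^ 2) ^ c else 0 := by
  have hz : HasSum (fun m => zL (fun a b => greenSummand q m a b c d) a (b - 1))
      (zL (fun a b => green q a b c d) a (b - 1)) := by
    simp only [zL]
    split_ifs
    · exact hasSum_zero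
    · exact (summable_greenSummand hq0 hq1 _ _ c d).hasSum
  have hsum : HasSum (fun m => lap q (fun a b => greenSummand q m a b c d) a b)
      (lap q (fun a b => green q a b c d) a b) :=
    ((((summable_greenSummand hq0 hq1 (a + 1) (b + 1) c d).hasSum.sub
      (summable_greenSummand hq0 hq1 a b c d).hasSum).mul_left _).sub
      (((summable_greenSummand hq0 hq1 a b c d).hasSum.sub hz).mul_left _))
  have hstep : ∀ m, lap q (fun a b => greenSummand q m a b c d) a b
      = (((1 - q ^ 2) * ((1 - (q ^ 2) ^ (m + 1)) * greenR q (m + 1 + 1) a b c d) : ℝ) : ℂ)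
        - (((1 - q ^ 2) * ((1 - (q ^ 2) ^ m) * greenR q (m + 1) a b c d) : ℝ) : ℂ) := by
    intro m
    have hlin : ∀ (r : ℂ) (w : Distr), lap q (fun a b => r * w a b) a b = r * lap q w a b := by
      intro r w
      simp only [lap, zL]
      split_ifs <;> ring
    have h1 := (one_sub_pow_pos hq0 hq1 m).ne'
    have h2 : (q ^ 2) ^ m ≠ 0 := by positivity
    simp only [greenSummand_eq hq0 hq1, Complex.ofReal_mul]
    rw [hlin, lap_greenR hq0 hq1]
    simp only [← Complex.ofReal_mul, ← Complex.ofReal_sub]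
    congr 1
    field_simp
    ring
  have ht := hsum.tendsto_sum_nat
  simp only [hstep] at ht
  -- Only the end terms survive; the one at `m = 0` has the factor `1 - t^0 = 0`, and `hl` gives the
  -- limit of the other.
  simp only [Finset.sum_range_sub (fun m => (((1 - q ^ 2) * ((1 - (q ^ 2) ^ m)
    * greenR q (m + 1) a b c d) : ℝ) : ℂ))] at ht
  have hl : Tendsto (fun m : ℕ => (1 - q ^ 2) * ((1 - (q ^ 2) ^ m) * greenR q (m + 1) a b c d))
      atTop (𝓝 ((1 - q ^ 2) * ((1 - 0) * if a = d ∧ b = c then (q ^ 2) ^ c else 0))) :=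
    ((tendsto_const_nhds.sub (tendsto_pow_sq hq0 hq1 0)).mul
      ((tendsto_add_atTop_iff_nat 1).2 (tendsto_greenR hq0 hq1 a b c d))).const_mul _
  simp only [pow_zero, sub_self, zero_mul, mul_zero, Complex.ofReal_zero, sub_zero] at ht
  rw [tendsto_nhds_unique ht ((Complex.continuous_ofReal.tendsto _).comp hl)]
  split_ifs <;> simp

/-! ### Entries of the operators -/

theorem IsFin.exists_bound {f : Distr} (hf : IsFin f) :
    ∃ N : ℕ, ∀ m n, f m n ≠ 0 → m ≤ N ∧ n ≤ N := by
  obtain ⟨⟨M, N⟩, h⟩ := Set.Finite.bddAbove hf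
  refine ⟨max M N, fun m n hmn => ?_⟩
  have h1 : (m, n) ≤ (M, N) := h hmn
  exact ⟨h1.1.trans (le_max_left _ _), h1.2.trans (le_max_right _ _)⟩

theorem isFin_of_bound {f : Distr} {N : ℕ} (h : ∀ m n, f m n ≠ 0 → m ≤ N ∧ n ≤ N) : IsFin f :=
  (Set.finite_Iic (N, N)).subset fun _ hp => ⟨(h _ _ hp).1, (h _ _ hp).2⟩

/-- Against a finite function the integral is a finite linear combination of slices of the kernel,
so linear operators in `z` pass under it without any convergence argument. -/
theorem intMu_eq_sum (q : ℝ) (K : Ker) {f : Distr} {N : ℕ}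
    (h : ∀ m n, f m n ≠ 0 → m ≤ N ∧ n ≤ N) :
    intMu q K f = fun a b => ∑ p ∈ Finset.range (N + 1) ×ˢ Finset.range (N + 1),
      ((1 - (q : ℂ) ^ 2) * f p.2 p.1 * ((q : ℂ) ^ 2) ^ p.1) * K a b p.1 p.2 := by
  have h0 : ∀ m n, (m ∉ Finset.range (N + 1) ∨ n ∉ Finset.range (N + 1)) → f m n = 0 := by
    intro m n hmn
    by_contra hne
    have := h m n hne
    simp only [Finset.mem_range] at hmn
    omega
  funext a b
  have h1 : ∀ c, mul (K a b) f c c = ∑ k ∈ Finset.range (N + 1), K a b c k * f k c := fun c =>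
    tsum_eq_sum fun k hk => by rw [h0 k c (Or.inl hk), mul_zero]
  rw [intMu, mu, tsum_eq_sum (s := Finset.range (N + 1)), Finset.sum_product, Finset.mul_sum]
  · apply Finset.sum_congr rfl
    intro c _
    rw [h1, Finset.sum_mul, Finset.mul_sum]
    apply Finset.sum_congr rfl
    intro k _
    rw [pow_mul]
    ring
  · intro c hc
    rw [h1, Finset.sum_eq_zero, zero_mul]
    intro k _
    rw [h0 k c (Or.inr hc), mul_zero]

theorem intNu_eq_intMu (q : ℝ) (K : Ker) (f : Distr) :
    intNu q K f = intMu q K (yR q (-2) f) := by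
  funext a b
  simp only [intNu, intMu, mu, yR, mul, ← mul_assoc, tsum_mul_right]

theorem dzbar_apply (q : ℝ) (w : Distr) (m n : ℕ) :
    dzbar q w m n = (1 - (q : ℂ) ^ 2)⁻¹ * ((w m (n + 1) - zL w m n) * (((q : ℂ) ^ 2) ^ n)⁻¹) := by
  have : (q : ℂ) ^ (2 * (-1 : ℤ) * (n : ℤ)) = (((q : ℂ) ^ 2) ^ n)⁻¹ := by
    rw [← pow_mul, ← zpow_natCast, ← zpow_neg]; congr 1
  simp only [dzbar, yR, zR, this, Pi.smul_apply, Pi.sub_apply, smul_eq_mul]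

theorem dz_apply (q : ℝ) (w : Distr) (m n : ℕ) :
    dz q w m n = (1 - (q : ℂ) ^ 2)⁻¹ * ((((q : ℂ) ^ 2) ^ m)⁻¹ *
      ((1 - ((q : ℂ) ^ 2) ^ (m + 1)) * w (m + 1) n
        - (1 - ((q : ℂ) ^ 2) ^ n) * w m (n - 1))) := by
  have : (q : ℂ) ^ (2 * (-1 : ℤ) * (m : ℤ)) = (((q : ℂ) ^ 2) ^ m)⁻¹ := by
    rw [← pow_mul, ← zpow_natCast, ← zpow_neg]; congr 1
  simp only [dz, yL, zsL, zsR, this, Pi.smul_apply, Pi.sub_apply, smul_eq_mul, pow_mul]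
  split_ifs with h
  · subst h; simp
  · rfl

theorem dzbar_sub (q : ℝ) (f g : Distr) : dzbar q (f - g) = dzbar q f - dzbar q g := by
  funext m n
  simp only [Pi.sub_apply, dzbar_apply, zL]
  split_ifs <;> ring

/-- The link between the two problems: `y (∂̄ ∂ w) y` is `□ w`, so a potential for `y f y` yields a
primitive of `f`. -/
theorem dzbar_dz {q : ℝ} (hq0 : 0 < q) (w : Distr) (a b : ℕ) :
    dzbar q (dz q w) a b = (1 - (q : ℂ) ^ 2)⁻¹ ^ 2 * (((q : ℂ) ^ 2) ^ a)⁻¹ *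
      (((q : ℂ) ^ 2) ^ b)⁻¹ * lap q w a b := by
  have hq : (q : ℂ) ^ 2 ≠ 0 := by
    have : (q : ℂ) ≠ 0 := by exact_mod_cast hq0.ne'
    positivity
  rcases a with _ | a
  · simp only [dzbar_apply, lap, zL, dz_apply, if_true, Nat.add_sub_cancel]
    ring
  · simp only [dzbar_apply, lap, zL, dz_apply, if_neg (Nat.succ_ne_zero a), Nat.add_sub_cancel]
    rw [pow_succ _ a, mul_inv]
    have h1 : ((q : ℂ) ^ 2)⁻¹ * (q : ℂ) ^ 2 = 1 := inv_mul_cancel₀ hq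
    generalize ((q : ℂ) ^ 2)⁻¹ = s at *
    generalize hA : ((q : ℂ) ^ 2) ^ a = A at *
    have h2 : ((q : ℂ) ^ 2) ^ (a + 1 + 1) = A * (q : ℂ) ^ 2 * (q : ℂ) ^ 2 := by
      rw [← hA]; ring
    have h3 : ((q : ℂ) ^ 2) ^ (b + 1) = ((q : ℂ) ^ 2) ^ b * (q : ℂ) ^ 2 := pow_succ _ _
    rw [h2, h3]
    generalize ((q : ℂ) ^ 2) ^ b = B at *
    generalize (q : ℂ) ^ 2 = t at *
    generalize A⁻¹ = A' at *
    generalize B⁻¹ = B' at *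
    generalize (1 - t)⁻¹ = e at *
    linear_combination (e ^ 2 * B' * A' * ((1 - A * t) * w (a + 1) b - (1 - B) * w a (b - 1))) * h1

theorem lap_sum {ι : Type*} (q : ℝ) (s : Finset ι) (r : ι → ℂ) (W : ι → Distr) (a b : ℕ) :
    lap q (fun a b => ∑ i ∈ s, r i * W i a b) a b = ∑ i ∈ s, r i * lap q (W i) a b := by
  classical
  induction s using Finset.induction_on with
  | empty => simp [lap, zL]
  | insert i s hi ih =>
    rw [Finset.sum_insert hi, ← ih]
    simp only [lap, zL, Finset.sum_insert hi]
    split_ifs <;> ring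

theorem dz_sum {ι : Type*} (q : ℝ) (s : Finset ι) (r : ι → ℂ) (W : ι → Distr) (a b : ℕ) :
    dz q (fun a b => ∑ i ∈ s, r i * W i a b) a b = ∑ i ∈ s, r i * dz q (W i) a b := by
  classical
  induction s using Finset.induction_on with
  | empty => simp [dz_apply]
  | insert i s hi ih =>
    rw [Finset.sum_insert hi, ← ih]
    simp only [dz_apply, Finset.sum_insert hi]
    ring

theorem dz_intMu (q : ℝ) (K : Ker) {f : Distr} (hf : IsFin f) :
    intMu q (inZ (dz q) K) f = dz q (intMu q K f) := by
  obtain ⟨N, h⟩ := hf.exists_bound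
  rw [intMu_eq_sum q _ h, intMu_eq_sum q _ h]
  funext a b
  rw [dz_sum q _ _ (fun p : ℕ × ℕ => fun a b => K a b p.1 p.2)]
  rfl

theorem IsFin.yR {f : Distr} (hf : IsFin f) (q : ℝ) (s : ℤ) : IsFin (yR q s f) :=
  Set.Finite.subset hf fun p hp h => hp (by simp [QDisc.yR, h])

theorem IsFin.yL {f : Distr} (hf : IsFin f) (q : ℝ) (s : ℤ) : IsFin (yL q s f) :=
  Set.Finite.subset hf fun p hp h => hp (by simp [QDisc.yL, h])

theorem IsFin.dzbar {f : Distr} (hf : IsFin f) (q : ℝ) : IsFin (dzbar q f) := by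
  obtain ⟨N, h⟩ := hf.exists_bound
  apply isFin_of_bound (N := N + 1)
  intro m n hmn
  by_contra hlt
  apply hmn
  have h1 : f m (n + 1) = 0 := by
    by_contra hne
    have := h _ _ hne
    omega
  have h2 : zL f m n = 0 := by
    rw [zL]
    split_ifs
    · rfl
    · by_contra hne
      have := h _ _ hne
      omega
  rw [dzbar_apply, h1, h2]
  simp

/-! ### The solution of the Poisson equation -/

theorem lap_intNu_green {q : ℝ} (hq0 : 0 < q) (hq1 : q < 1) {f : Distr} (hf : IsFin f) (a b : ℕ) :
    lap q (intNu q (green q) f) a b = (1 - (q : ℂ) ^ 2) ^ 2 * f a b := by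
  have hqc : (q : ℂ) ≠ 0 := by exact_mod_cast hq0.ne'
  obtain ⟨N, h⟩ := (hf.yR q (-2)).exists_bound
  rw [intNu_eq_intMu, intMu_eq_sum q _ h,
    lap_sum q _ _ (fun p : ℕ × ℕ => fun a b => green q a b p.1 p.2)]
  simp only [lap_green hq0 hq1]
  -- The density `y^{-2}` of `dν` cancels one `t^b` from `dμ` and one from `lap_green`.
  have e : (q : ℂ) ^ (2 * (-2 : ℤ) * (b : ℤ)) * (((q : ℂ) ^ 2) ^ b * ((q : ℂ) ^ 2) ^ b) = 1 := by
    rw [← pow_add, ← pow_mul, ← zpow_natCast, ← zpow_add₀ hqc, ← zpow_zero (q : ℂ)]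
    congr 1; push_cast; ring
  rw [Finset.sum_eq_single (b, a)]
  · simp only [and_self, if_true, yR]
    linear_combination ((1 - (q : ℂ) ^ 2) ^ 2 * f a b) * e
  · rintro ⟨c, d⟩ _ hne
    rw [if_neg, mul_zero]
    rintro ⟨rfl, rfl⟩
    exact hne rfl
  · intro hmem
    have : yR q (-2) f a b = 0 := by
      by_contra hne
      have := h _ _ hne
      simp only [Finset.mem_product, Finset.mem_range] at hmem
      omega
    simp [this]

theorem scal_apply (q : ℝ) (s : ℤ) (f g : Distr) : scal q s f g = (1 - (q : ℂ) ^ 2) *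
    ∑' p : ℕ × ℕ, (starRingEnd ℂ) (g p.1 p.2) * ((poch q p.1 / poch q p.2 : ℝ) : ℂ) * f p.1 p.2
      * (q : ℂ) ^ (2 * (s + 1) * (p.2 : ℤ)) := rfl

/-- Green's formula: the adjoint of `∂̄` on finite functions. -/
theorem scal_dzbar_dzbar {q : ℝ} (hq0 : 0 < q) (hq1 : q < 1) {f w g : Distr} (hg : IsFin g)
    (hw : ∀ a b, lap q w a b = (1 - (q : ℂ) ^ 2) ^ 2 * f a b) :
    -scal q 0 (dzbar q w) (dzbar q g) = scal q (-2) f g := by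
  have hqc : (q : ℂ) ≠ 0 := by exact_mod_cast hq0.ne'
  have ht : (1 - (q : ℂ) ^ 2) ≠ 0 := by exact_mod_cast (one_sub_sq_pos hq0 hq1).ne'
  set e : ℂ := (1 - (q : ℂ) ^ 2)⁻¹ with he
  set h := dzbar q w
  have hconj : ∀ n : ℕ, (starRingEnd ℂ) ((((q : ℂ) ^ 2) ^ n)⁻¹) = (((q : ℂ) ^ 2) ^ n)⁻¹ := by
    intro n; simp
  have hconje : (starRingEnd ℂ) e = e := by simp [he]
  -- Summation by parts: `∂̄ g` involves `g` shifted in the column and `g` shifted in the row. The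
  -- two resulting sums are `A' ∘ i` and `B`; reindexing them as `A'` and `B ∘ j` brings `g` to the
  -- same entry in both. All are finite sums because `g` is finite.
  let A' : ℕ × ℕ → ℂ := fun p => if p.2 = 0 then 0 else (starRingEnd ℂ) (g p.1 p.2) *
    (e * ((poch q p.1 / poch q (p.2 - 1) : ℝ) : ℂ) * h p.1 (p.2 - 1))
  let B : ℕ × ℕ → ℂ := fun p => if p.1 = 0 then 0 else (starRingEnd ℂ) (g (p.1 - 1) p.2) *
    (e * ((poch q p.1 / poch q p.2 : ℝ) : ℂ) * h p.1 p.2)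
  let i : ℕ × ℕ → ℕ × ℕ := fun p => (p.1, p.2 + 1)
  let j : ℕ × ℕ → ℕ × ℕ := fun p => (p.1 + 1, p.2)
  have hi : Function.Injective i := by
    rintro ⟨a, b⟩ ⟨c, d⟩ hab
    simpa [i] using hab
  have hj : Function.Injective j := by
    rintro ⟨a, b⟩ ⟨c, d⟩ hab
    simpa [j] using hab
  have hA'z : ∀ p, p ∉ Set.range i → A' p = 0 := by
    rintro ⟨a, _ | b⟩ hp
    · simp [A']
    · exact absurd ⟨(a, b), rfl⟩ hp
  have hBz : ∀ p, p ∉ Set.range j → B p = 0 := by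
    rintro ⟨_ | a, b⟩ hp
    · simp [B]
    · exact absurd ⟨(a, b), rfl⟩ hp
  have hA's : Summable A' := by
    apply summable_of_hasFiniteSupport
    refine Set.Finite.subset hg fun p hp h0 => hp ?_
    simp [A', h0]
  have hBjs : Summable (B ∘ j) := by
    apply summable_of_hasFiniteSupport
    refine Set.Finite.subset hg fun p hp h0 => hp ?_
    simp [B, j, h0]
  have hBs : Summable B := (hj.summable_iff hBz).1 hBjs
  have hAis : Summable (A' ∘ i) := hA's.comp_injective hi
  have hL : ∀ p : ℕ × ℕ, (starRingEnd ℂ) (dzbar q g p.1 p.2) *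
      ((poch q p.1 / poch q p.2 : ℝ) : ℂ) * h p.1 p.2 * (q : ℂ) ^ (2 * ((0 : ℤ) + 1) * (p.2 : ℤ))
      = (A' ∘ i) p - B p := by
    rintro ⟨a, b⟩
    have e1 : (q : ℂ) ^ (2 * ((0 : ℤ) + 1) * (b : ℤ)) = ((q : ℂ) ^ 2) ^ b := by
      rw [← pow_mul, ← zpow_natCast]; congr 1
    have e2 : ((q : ℂ) ^ 2) ^ b ≠ 0 := pow_ne_zero _ (pow_ne_zero _ hqc)
    have e3 : (starRingEnd ℂ) (zL g a b) = if a = 0 then 0 else (starRingEnd ℂ) (g (a - 1) b) := by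
      rw [zL]; split_ifs <;> simp
    have e4 : (((q : ℂ) ^ 2) ^ b)⁻¹ * ((q : ℂ) ^ 2) ^ b = 1 := inv_mul_cancel₀ e2
    rw [dzbar_apply, map_mul, map_mul, map_sub, hconj, ← he, hconje, e1, e3]
    simp only [A', B, i, Function.comp, if_neg (Nat.succ_ne_zero b), Nat.add_sub_cancel]
    generalize (((q : ℂ) ^ 2) ^ b)⁻¹ = Y at *
    generalize ((q : ℂ) ^ 2) ^ b = Z at *
    split_ifs
    · linear_combination (e * (starRingEnd ℂ) (g a (b + 1)) *
        ((poch q a / poch q b : ℝ) : ℂ) * h a b) * e4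
    · linear_combination (e * ((starRingEnd ℂ) (g a (b + 1)) - (starRingEnd ℂ) (g (a - 1) b)) *
        ((poch q a / poch q b : ℝ) : ℂ) * h a b) * e4
  rw [scal_apply, scal_apply, tsum_congr hL, hAis.tsum_sub hBs]
  have t1 : ∑' p, (A' ∘ i) p = ∑' p, A' p :=
    hi.tsum_eq fun p hp => by by_contra hn; exact hp (hA'z p hn)
  have t2 : ∑' p, B p = ∑' p, (B ∘ j) p :=
    (hj.tsum_eq fun p hp => by by_contra hn; exact hp (hBz p hn)).symm
  rw [t1, t2, ← hA's.tsum_sub hBjs, ← mul_neg, ← tsum_neg]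
  congr 1
  apply tsum_congr
  rintro ⟨a, b⟩
  have e1 : (q : ℂ) ^ (2 * ((-2 : ℤ) + 1) * (b : ℤ)) = (((q : ℂ) ^ 2) ^ b)⁻¹ := by
    rw [← pow_mul, ← zpow_natCast, ← zpow_neg]; congr 1
  have e2 : f a b = e ^ 2 * lap q w a b := by
    rw [hw, he]; field_simp
  have e3 : ((poch q (a + 1) / poch q b : ℝ) : ℂ)
      = ((poch q a / poch q b : ℝ) : ℂ) * (1 - ((q : ℂ) ^ 2) ^ (a + 1)) := by
    rw [poch_succ]; push_cast; ring
  have hh1 : ∀ m n, h m n = e * ((w m (n + 1) - zL w m n) * (((q : ℂ) ^ 2) ^ n)⁻¹) :=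
    fun m n => dzbar_apply q w m n
  have hzl : ∀ n, zL w (a + 1) n = w a n := fun n => by simp [zL]
  rw [e1, e2]
  simp only [A', B, j, Function.comp, if_neg (Nat.succ_ne_zero a), Nat.add_sub_cancel, e3, lap,
    hh1, hzl]
  rcases b with _ | b
  · simp
    ring
  · have e4 : ((poch q a / poch q b : ℝ) : ℂ)
        = ((poch q a / poch q (b + 1) : ℝ) : ℂ) * (1 - ((q : ℂ) ^ 2) ^ (b + 1)) := by
      have h1 := (poch_pos hq0 hq1 b).ne'
      have h2 := (one_sub_pow_pos hq0 hq1 b).ne'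
      rw [poch_succ]
      have : poch q a / poch q b
        = poch q a / (poch q b * (1 - (q ^ 2) ^ (b + 1))) * (1 - (q ^ 2) ^ (b + 1)) := by
        field_simp
      rw [this]; push_cast; ring
    have e5 : (((q : ℂ) ^ 2) ^ b)⁻¹ = (((q : ℂ) ^ 2) ^ (b + 1))⁻¹ * (q : ℂ) ^ 2 := by
      rw [pow_succ _ b, mul_inv, mul_assoc, inv_mul_cancel₀ (pow_ne_zero _ hqc), mul_one]
    simp only [if_neg (Nat.succ_ne_zero b), Nat.add_sub_cancel, e4, e5]
    ring

/-! ### Square summability -/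

/-- Matrices supported on finitely many diagonals. -/
def IsBand (N : ℕ) (w : Distr) : Prop := ∀ a b, w a b ≠ 0 → a ≤ b + N ∧ b ≤ a + N

/-- On a band the ratio of `q`-factorials is bounded and `t^b = q^b q^b ≤ q^{-N} q^a q^b`, which is
summable over all pairs. -/
theorem memL2_of_isBand {q : ℝ} (hq0 : 0 < q) (hq1 : q < 1) {s : ℤ} {N : ℕ} {C : ℝ} {w : Distr}
    (hw : IsBand N w)
    (hC : ∀ a b, ‖w a b‖ ^ 2 * q ^ (2 * (s + 1) * (b : ℤ)) ≤ C * (q ^ 2) ^ b) : MemL2 q s w := by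
  have hs : Summable fun p : ℕ × ℕ => q ^ p.1 * q ^ p.2 :=
    (summable_geometric_of_lt_one hq0.le hq1).mul_of_nonneg
      (summable_geometric_of_lt_one hq0.le hq1) (fun _ => by positivity) (fun _ => by positivity)
  have hC0 : 0 ≤ C := by
    have := hC 0 0
    simp only [pow_zero, mul_one] at this
    exact le_trans (by positivity) this
  have hD := one_le_inv_one_sub hq0 hq1
  have hp := poch_pos hq0 hq1
  refine Summable.of_nonneg_of_le (fun p => ?_) (fun p => ?_)
    (hs.mul_left (((1 - q ^ 2)⁻¹) ^ N * C * (q ^ N)⁻¹))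
  · have := hp p.1
    have := hp p.2
    positivity
  · obtain ⟨a, b⟩ := p
    simp only
    by_cases h0 : w a b = 0
    · rw [h0]
      simp only [norm_zero, ne_eq, OfNat.ofNat_ne_zero, not_false_eq_true, zero_pow, zero_mul]
      positivity
    · obtain ⟨h1, h2⟩ := hw a b h0
      have h3 := poch_div_le hq0 hq1 h2
      have h4 : q ^ b ≤ (q ^ N)⁻¹ * q ^ a := by
        rw [inv_mul_eq_div, le_div_iff₀ (by positivity), ← pow_add]
        exact pow_le_pow_of_le_one hq0.le hq1.le h1
      have h5 : 0 ≤ poch q a / poch q b := (div_pos (hp a) (hp b)).le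
      calc _ = (‖w a b‖ ^ 2 * q ^ (2 * (s + 1) * (b : ℤ))) * (poch q a / poch q b) := by ring
        _ ≤ (C * (q ^ 2) ^ b) * ((1 - q ^ 2)⁻¹) ^ N := by
          exact mul_le_mul (hC a b) h3 h5 (by positivity)
        _ = ((1 - q ^ 2)⁻¹) ^ N * C * (q ^ b * q ^ b) := by ring
        _ ≤ ((1 - q ^ 2)⁻¹) ^ N * C * (((q ^ N)⁻¹ * q ^ a) * q ^ b) := by gcongr
        _ = _ := by ring

theorem IsFin.memL2 {f : Distr} (hf : IsFin f) (q : ℝ) (s : ℤ) : MemL2 q s f := by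
  apply summable_of_hasFiniteSupport
  exact Set.Finite.subset hf fun _ hp h0 => hp (by simp [h0])

theorem MemL2.sub {q : ℝ} (hq0 : 0 < q) (hq1 : q < 1) {s : ℤ} {f g : Distr} (hf : MemL2 q s f)
    (hg : MemL2 q s g) : MemL2 q s (f - g) := by
  have hp := poch_pos hq0 hq1
  refine Summable.of_nonneg_of_le (fun p => ?_) (fun p => ?_) ((hf.add hg).mul_left 2)
  · have := hp p.1
    have := hp p.2
    positivity
  · have h1 : ‖f p.1 p.2 - g p.1 p.2‖ ^ 2 ≤ 2 * (‖f p.1 p.2‖ ^ 2 + ‖g p.1 p.2‖ ^ 2) := by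
      have := norm_sub_le (f p.1 p.2) (g p.1 p.2)
      nlinarith [sq_nonneg (‖f p.1 p.2‖ - ‖g p.1 p.2‖), norm_nonneg (f p.1 p.2 - g p.1 p.2)]
    have h2 : 0 ≤ (poch q p.1 / poch q p.2) * q ^ (2 * (s + 1) * (p.2 : ℤ)) := by
      have := hp p.1
      have := hp p.2
      positivity
    have := mul_le_mul_of_nonneg_right h1 h2
    simp only [Pi.sub_apply]
    linarith

theorem intNu_green_bound {q : ℝ} (hq0 : 0 < q) (hq1 : q < 1) {f : Distr} (hf : IsFin f) :
    ∃ (N : ℕ) (C : ℝ), 0 ≤ C ∧ IsBand N (intNu q (green q) f) ∧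
      ∀ a b, ‖intNu q (green q) f a b‖ ≤ C * (q ^ 2) ^ b := by
  obtain ⟨N, h⟩ := (hf.yR q (-2)).exists_bound
  rw [intNu_eq_intMu, intMu_eq_sum q _ h]
  have hD := one_le_inv_one_sub hq0 hq1
  have hB := boundG_nonneg hq0 hq1 N
  refine ⟨N, ∑ p ∈ Finset.range (N + 1) ×ˢ Finset.range (N + 1),
    ‖(1 - (q : ℂ) ^ 2) * yR q (-2) f p.2 p.1 * ((q : ℂ) ^ 2) ^ p.1‖
      * ((1 - q ^ 2)⁻¹ * boundG q N), ?_, ?_, ?_⟩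
  · exact Finset.sum_nonneg fun p _ => by positivity
  · intro a b hab
    obtain ⟨⟨c, d⟩, hp, hne⟩ := Finset.exists_ne_zero_of_sum_ne_zero hab
    simp only [Finset.mem_product, Finset.mem_range] at hp
    -- The Green function is supported on `a + c = b + d`; with `c, d ≤ N` this forces the band.
    have : a + c = b + d := by
      by_contra hc
      exact hne (by simp only [green_eq_zero hq0 hq1 hc, mul_zero])
    omega
  · intro a b
    rw [Finset.sum_mul]
    refine (norm_sum_le _ _).trans (Finset.sum_le_sum fun p hp => ?_)
    simp only [Finset.mem_product, Finset.mem_range] at hp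
    rw [norm_mul]
    exact (mul_le_mul_of_nonneg_left (norm_green_le hq0 hq1 (N := N) (by omega) (by omega))
      (norm_nonneg _)).trans_eq (by ring)

theorem poissonSol_green {q : ℝ} (hq0 : 0 < q) (hq1 : q < 1) {f : Distr} (hf : IsFin f) :
    PoissonSol q f (intNu q (green q) f) := by
  refine ⟨?_, fun g hg => scal_dzbar_dzbar hq0 hq1 hg (lap_intNu_green hq0 hq1 hf)⟩
  obtain ⟨N, C, hC, hband, hle⟩ := intNu_green_bound hq0 hq1 hf
  refine memL2_of_isBand hq0 hq1 (C := C ^ 2) hband fun a b => ?_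
  have e : q ^ (2 * ((-2 : ℤ) + 1) * (b : ℤ)) = ((q ^ 2) ^ b)⁻¹ := by
    rw [← pow_mul, ← zpow_natCast, ← zpow_neg]; congr 1
  rw [e, ← div_eq_mul_inv, div_le_iff₀ (by positivity)]
  calc _ ≤ (C * (q ^ 2) ^ b) ^ 2 := by gcongr; exact hle a b
    _ = _ := by ring

/-! ### Orthogonality to the kernel of `∂̄` -/

/-- The weight of the scalar product of `L²(dμ)_q`. -/
def weight (q : ℝ) (m n : ℕ) : ℝ := poch q m / poch q n * (q ^ 2) ^ n

theorem weight_pos {q : ℝ} (hq0 : 0 < q) (hq1 : q < 1) (m n : ℕ) : 0 < weight q m n := by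
  have := poch_pos hq0 hq1 m
  have := poch_pos hq0 hq1 n
  rw [weight]
  positivity

theorem memL2_zero_iff (q : ℝ) (f : Distr) :
    MemL2 q 0 f ↔ Summable fun p : ℕ × ℕ => ‖f p.1 p.2‖ ^ 2 * weight q p.1 p.2 := by
  have : ∀ n : ℕ, q ^ (2 * ((0 : ℤ) + 1) * (n : ℤ)) = (q ^ 2) ^ n := by
    intro n
    rw [← pow_mul, ← zpow_natCast]; congr 1
  simp only [MemL2, this, weight, ← mul_assoc]

theorem scal_zero_apply (q : ℝ) (f g : Distr) : scal q 0 f g = (1 - (q : ℂ) ^ 2) *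
    ∑' p : ℕ × ℕ, (starRingEnd ℂ) (g p.1 p.2) * f p.1 p.2 * ((weight q p.1 p.2 : ℝ) : ℂ) := by
  rw [scal_apply]
  congr 1
  apply tsum_congr
  intro p
  have : (q : ℂ) ^ (2 * ((0 : ℤ) + 1) * (p.2 : ℤ)) = ((q : ℂ) ^ 2) ^ p.2 := by
    rw [← pow_mul, ← zpow_natCast]; congr 1
  rw [this, weight]
  push_cast
  ring

theorem summable_scal {q : ℝ} (hq0 : 0 < q) (hq1 : q < 1) {f g : Distr} (hf : MemL2 q 0 f)
    (hg : MemL2 q 0 g) : Summable fun p : ℕ × ℕ =>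
      (starRingEnd ℂ) (g p.1 p.2) * f p.1 p.2 * ((weight q p.1 p.2 : ℝ) : ℂ) := by
  rw [memL2_zero_iff] at hf hg
  refine Summable.of_norm_bounded (hf.add hg) fun p => ?_
  have hw := weight_pos hq0 hq1 p.1 p.2
  rw [norm_mul, norm_mul, RCLike.norm_conj, Complex.norm_real, Real.norm_of_nonneg hw.le,
    ← add_mul]
  gcongr
  nlinarith [sq_nonneg (‖f p.1 p.2‖ - ‖g p.1 p.2‖), sq_nonneg ‖f p.1 p.2‖,
    sq_nonneg ‖g p.1 p.2‖]

/-- The difference lies in the kernel of `∂̄` and is orthogonal to it, hence to itself; the weights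
are positive. -/
theorem dbarSol_unique {q : ℝ} (hq0 : 0 < q) (hq1 : q < 1) {f u v : Distr} (hu : DbarSol q f u)
    (hv : DbarSol q f v) : u = v := by
  obtain ⟨hu1, hu2, hu3⟩ := hu
  obtain ⟨hv1, hv2, hv3⟩ := hv
  have hm : MemL2 q 0 (u - v) := hu1.sub hq0 hq1 hv1
  have hk : dzbar q (u - v) = 0 := by rw [dzbar_sub, hu2, hv2, sub_self]
  have h1 := hu3 _ hm hk
  have h2 := hv3 _ hm hk
  have ht : (1 - (q : ℂ) ^ 2) ≠ 0 := by exact_mod_cast (one_sub_sq_pos hq0 hq1).ne'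
  rw [scal_zero_apply, mul_eq_zero_iff_left ht] at h1 h2
  have h3 := (summable_scal hq0 hq1 hu1 hm).tsum_sub (summable_scal hq0 hq1 hv1 hm)
  rw [h1, h2, sub_zero] at h3
  have h4 : ∑' p : ℕ × ℕ, (((‖(u - v) p.1 p.2‖ ^ 2 * weight q p.1 p.2 : ℝ)) : ℂ) = 0 := by
    rw [← h3]
    apply tsum_congr
    intro p
    rw [← sub_mul, ← mul_sub, ← Pi.sub_apply, ← Pi.sub_apply, RCLike.conj_mul]
    push_cast
    rfl
  rw [← Complex.ofReal_tsum, Complex.ofReal_eq_zero] at h4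
  have h5 : ∀ p : ℕ × ℕ, 0 ≤ ‖(u - v) p.1 p.2‖ ^ 2 * weight q p.1 p.2 := fun p => by
    have := weight_pos hq0 hq1 p.1 p.2
    positivity
  have h6 := ((memL2_zero_iff q _).1 hm).hasSum
  rw [h4, hasSum_zero_iff_of_nonneg h5] at h6
  funext a b
  have h7 := congrFun h6 (a, b)
  have h8 := (weight_pos hq0 hq1 a b).ne'
  simp only [Pi.zero_apply, mul_eq_zero, h8, or_false, ne_eq, OfNat.ofNat_ne_zero,
    not_false_eq_true, pow_eq_zero_iff, norm_eq_zero, Pi.sub_apply] at h7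
  exact sub_eq_zero.1 h7

theorem dzbar_eq_zero_iff {q : ℝ} (hq0 : 0 < q) (hq1 : q < 1) (g : Distr) :
    dzbar q g = 0 ↔ ∀ m n, g m (n + 1) = zL g m n := by
  have ht : (1 - (q : ℂ) ^ 2)⁻¹ ≠ 0 := by
    apply inv_ne_zero
    exact_mod_cast (one_sub_sq_pos hq0 hq1).ne'
  have hq : (q : ℂ) ≠ 0 := by exact_mod_cast hq0.ne'
  constructor
  · intro h m n
    have h1 := congrFun (congrFun h m) n
    have h2 : (((q : ℂ) ^ 2) ^ n)⁻¹ ≠ 0 := inv_ne_zero (pow_ne_zero _ (pow_ne_zero _ hq))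
    simp only [dzbar_apply, Pi.zero_apply, mul_eq_zero, ht, h2, false_or, or_false] at h1
    exact sub_eq_zero.1 h1
  · intro h
    funext m n
    rw [dzbar_apply, h, sub_self]
    simp

/-- Following a diagonal upwards ends in column `0` if it starts on or below the main diagonal, and
otherwise leaves through row `0`, where the entry vanishes (`ker_dzbar_above`). So `g` is the matrix
of a power series in `z`. -/
theorem ker_dzbar_diag {g : Distr} (hg : ∀ m n, g m (n + 1) = zL g m n) (k n : ℕ) :
    g (n + k) n = g k 0 := by
  induction n with
  | zero => simp
  | succ n ih =>
    rw [hg, show n + 1 + k = n + k + 1 by ring]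
    exact ih

theorem ker_dzbar_above {g : Distr} (hg : ∀ m n, g m (n + 1) = zL g m n) (m k : ℕ) :
    g m (m + k + 1) = 0 := by
  induction m with
  | zero => rw [hg]; rfl
  | succ m ih =>
    rw [hg, show m + 1 + k = m + k + 1 by ring]
    exact ih

theorem scal_eq_zero_of_diag {q : ℝ} (hq0 : 0 < q) (hq1 : q < 1) {u g : Distr} (hu : MemL2 q 0 u)
    (hg : MemL2 q 0 g) (hk : dzbar q g = 0)
    (h : ∀ k : ℕ, HasSum (fun n => u (n + k) n * ((weight q (n + k) n : ℝ) : ℂ)) 0) :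
    scal q 0 u g = 0 := by
  rw [dzbar_eq_zero_iff hq0 hq1] at hk
  let e : ℕ × ℕ → ℕ × ℕ := fun p => (p.2 + p.1, p.2)
  have he : Function.Injective e := by
    rintro ⟨a, b⟩ ⟨c, d⟩ hab
    simp only [e, Prod.mk.injEq] at hab
    ext <;> simp only <;> omega
  have hs := summable_scal hq0 hq1 hu hg
  have h1 := he.tsum_eq (f := fun p : ℕ × ℕ =>
    (starRingEnd ℂ) (g p.1 p.2) * u p.1 p.2 * ((weight q p.1 p.2 : ℝ) : ℂ)) (by
      rintro ⟨m, n⟩ hp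
      by_contra hr
      apply hp
      have hmn : m < n := by
        by_contra hle
        exact hr ⟨(m - n, n), by simp only [e, Prod.mk.injEq, and_true]; omega⟩
      obtain ⟨k, rfl⟩ := Nat.exists_eq_add_of_lt hmn
      simp [ker_dzbar_above hk])
  have h3 := (hs.comp_injective he).tsum_prod
  simp only [Function.comp] at h3
  rw [scal_zero_apply, ← h1, h3]
  have h2 : ∀ k, ∑' n, (starRingEnd ℂ) (g (n + k) n) * u (n + k) n
      * ((weight q (n + k) n : ℝ) : ℂ) = 0 := by
    intro k
    simp only [ker_dzbar_diag hk, mul_assoc, tsum_mul_left, (h k).tsum_eq, mul_zero]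
  simp only [e, h2, tsum_zero, mul_zero]

/-! ### The solution of the `∂̄`-problem -/

/-- The growth `t^{-a}` of `y^{-1}` is absorbed by the decay `t^b` of `w`, since `a ≤ b + N + 1` on
the band of `dz q w`. -/
theorem dz_bound {q : ℝ} (hq0 : 0 < q) (hq1 : q < 1) {w : Distr} {N : ℕ} {C : ℝ} (hC : 0 ≤ C)
    (hband : IsBand N w) (hle : ∀ a b, ‖w a b‖ ≤ C * (q ^ 2) ^ b) :
    IsBand (N + 1) (dz q w) ∧ ∃ C', 0 ≤ C' ∧ ∀ a b, ‖dz q w a b‖ ≤ C' := by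
  have hb : IsBand (N + 1) (dz q w) := by
    intro a b hab
    by_contra hn
    apply hab
    have h1 : w (a + 1) b = 0 := by
      by_contra hne
      have := hband _ _ hne
      omega
    rcases b with _ | b
    · rw [dz_apply, h1]; simp
    · have h2 : w a (b + 1 - 1) = 0 := by
        by_contra hne
        have := hband _ _ hne
        omega
      rw [dz_apply, h1, h2]; simp
  have hD := one_le_inv_one_sub hq0 hq1
  have ht := one_sub_sq_pos hq0 hq1
  refine ⟨hb, (1 - q ^ 2)⁻¹ * (((q ^ 2) ^ (N + 1))⁻¹ * (C + C * (q ^ 2)⁻¹)), by positivity, ?_⟩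
  intro a b
  by_cases h0 : dz q w a b = 0
  · rw [h0, norm_zero]; positivity
  obtain ⟨h1, -⟩ := hb a b h0
  have hnorm1 : ‖(1 - (q : ℂ) ^ 2)⁻¹‖ = (1 - q ^ 2)⁻¹ := by
    rw [norm_inv, inv_inj]
    have : (1 - (q : ℂ) ^ 2) = ((1 - q ^ 2 : ℝ) : ℂ) := by push_cast; ring
    rw [this, Complex.norm_real, Real.norm_of_nonneg ht.le]
  have hnorm2 : ‖(((q : ℂ) ^ 2) ^ a)⁻¹‖ = ((q ^ 2) ^ a)⁻¹ := by
    rw [norm_inv, norm_pow, norm_pow, Complex.norm_real, Real.norm_of_nonneg hq0.le]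
  have hnorm3 : ∀ n : ℕ, ‖1 - ((q : ℂ) ^ 2) ^ n‖ ≤ 1 := by
    intro n
    have : (1 - ((q : ℂ) ^ 2) ^ n) = ((1 - (q ^ 2) ^ n : ℝ) : ℂ) := by push_cast; ring
    have h2 : (q ^ 2) ^ n ≤ 1 := pow_le_one₀ (by positivity) (by nlinarith)
    have h3 : 0 < (q ^ 2) ^ n := by positivity
    rw [this, Complex.norm_real, Real.norm_of_nonneg (by linarith)]
    linarith
  have hw1 : ‖(1 - ((q : ℂ) ^ 2) ^ (a + 1)) * w (a + 1) b‖ ≤ C * (q ^ 2) ^ b := by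
    rw [norm_mul]
    calc _ ≤ 1 * (C * (q ^ 2) ^ b) :=
          mul_le_mul (hnorm3 _) (hle _ _) (norm_nonneg _) zero_le_one
      _ = _ := one_mul _
  have hw2 : ‖(1 - ((q : ℂ) ^ 2) ^ b) * w a (b - 1)‖ ≤ C * (q ^ 2)⁻¹ * (q ^ 2) ^ b := by
    rcases b with _ | b
    · simp only [pow_zero, sub_self, zero_mul, norm_zero]; positivity
    · rw [norm_mul]
      calc _ ≤ 1 * (C * (q ^ 2) ^ b) :=
            mul_le_mul (hnorm3 _) (hle _ _) (norm_nonneg _) zero_le_one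
        _ = _ := by
            rw [pow_succ _ b]
            field_simp
  have h2 : ((q ^ 2) ^ a)⁻¹ * (q ^ 2) ^ b ≤ ((q ^ 2) ^ (N + 1))⁻¹ := by
    rw [inv_mul_eq_div, div_le_iff₀ (by positivity), inv_mul_eq_div, le_div_iff₀ (by positivity),
      ← pow_add]
    exact pow_le_pow_of_le_one (by positivity) (by nlinarith) h1
  rw [dz_apply, norm_mul, norm_mul, hnorm1, hnorm2]
  calc _ ≤ (1 - q ^ 2)⁻¹ * (((q ^ 2) ^ a)⁻¹ * (C * (q ^ 2) ^ b + C * (q ^ 2)⁻¹ * (q ^ 2) ^ b)) := by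
        gcongr
        exact (norm_sub_le _ _).trans (add_le_add hw1 hw2)
    _ = (1 - q ^ 2)⁻¹ * ((((q ^ 2) ^ a)⁻¹ * (q ^ 2) ^ b) * (C + C * (q ^ 2)⁻¹)) := by ring
    _ ≤ _ := by gcongr

theorem poch_add_div_le_one {q : ℝ} (hq0 : 0 < q) (hq1 : q < 1) (n k : ℕ) :
    poch q (n + k) / poch q n ≤ 1 :=
  (div_le_one (poch_pos hq0 hq1 n)).2 (poch_add_le hq0 hq1 n k)

/-- On the `k`-th diagonal the weighted entries are a constant times `v (n + 1) - v n` with `v`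
summable, so the total is a multiple of `v 0`. This is zero by the factor `1 - t^0`, whatever the
truncated index `n - 1` gives there. -/
theorem hasSum_dz_diag {q : ℝ} (hq0 : 0 < q) (hq1 : q < 1) {w : Distr} {C : ℝ}
    (hle : ∀ a b, ‖w a b‖ ≤ C * (q ^ 2) ^ b) (k : ℕ) :
    HasSum (fun n => dz q w (n + k) n * ((weight q (n + k) n : ℝ) : ℂ)) 0 := by
  have hqc : (q : ℂ) ≠ 0 := by exact_mod_cast hq0.ne'
  let v : ℕ → ℂ := fun n =>
    ((poch q (n + k) / poch q n * (1 - (q ^ 2) ^ n) : ℝ) : ℂ) * w (n + k) (n - 1)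
  have hv1 : ∀ n, v (n + 1) = ((poch q (n + k + 1) / poch q n : ℝ) : ℂ) * w (n + k + 1) n := by
    intro n
    have h1 := (poch_pos hq0 hq1 n).ne'
    have h2 := (one_sub_pow_pos hq0 hq1 n).ne'
    simp only [v, Nat.add_sub_cancel]
    rw [show n + 1 + k = n + k + 1 by ring]
    congr 2
    rw [poch_succ q n]
    field_simp
  have hs : Summable v := by
    rw [← summable_nat_add_iff 1]
    refine Summable.of_norm_bounded ((summable_pow_sq hq0 hq1).mul_left C) fun n => ?_
    have h1 := poch_add_div_le_one hq0 hq1 n (k + 1)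
    have h2 : 0 ≤ poch q (n + (k + 1)) / poch q n :=
      (div_pos (poch_pos hq0 hq1 _) (poch_pos hq0 hq1 _)).le
    rw [hv1, norm_mul, Complex.norm_real, add_assoc, Real.norm_of_nonneg h2]
    calc _ ≤ 1 * (C * (q ^ 2) ^ n) :=
          mul_le_mul h1 (hle _ _) (norm_nonneg _) zero_le_one
      _ = _ := one_mul _
  have h1 : HasSum (fun n => v (n + 1)) (∑' n, v n - v 0) := by
    have := (hasSum_nat_add_iff' 1).2 hs.hasSum
    simpa using this
  have hv0 : v 0 = 0 := by simp [v]
  have h2 := (h1.sub hs.hasSum).mul_left ((1 - (q : ℂ) ^ 2)⁻¹ * (((q : ℂ) ^ 2) ^ k)⁻¹)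
  rw [hv0, sub_zero, sub_self, mul_zero] at h2
  refine h2.congr_fun ?_
  intro n
  rw [hv1, dz_apply]
  simp only [v, weight]
  have e1 : ((q : ℂ) ^ 2) ^ n ≠ 0 := pow_ne_zero _ (pow_ne_zero _ hqc)
  have e2 : (((q : ℂ) ^ 2) ^ (n + k))⁻¹ * ((q : ℂ) ^ 2) ^ n = (((q : ℂ) ^ 2) ^ k)⁻¹ := by
    rw [pow_add, mul_inv, mul_comm, ← mul_assoc, mul_inv_cancel₀ e1, one_mul]
  rw [poch_succ q (n + k), ← e2]
  push_cast
  ring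

theorem dbarSol_dz {q : ℝ} (hq0 : 0 < q) (hq1 : q < 1) {w : Distr} {N : ℕ} {C : ℝ} (hC : 0 ≤ C)
    (hband : IsBand N w) (hle : ∀ a b, ‖w a b‖ ≤ C * (q ^ 2) ^ b) :
    DbarSol q (dzbar q (dz q w)) (dz q w) := by
  obtain ⟨hb, C', hC', hle'⟩ := dz_bound hq0 hq1 hC hband hle
  have hm : MemL2 q 0 (dz q w) := by
    refine memL2_of_isBand hq0 hq1 (C := C' ^ 2) hb fun a b => ?_
    have e : q ^ (2 * ((0 : ℤ) + 1) * (b : ℤ)) = (q ^ 2) ^ b := by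
      rw [← pow_mul, ← zpow_natCast]; congr 1
    rw [e]
    gcongr
    exact hle' a b
  exact ⟨hm, rfl, fun g hg hk =>
    scal_eq_zero_of_diag hq0 hq1 hm hg hk (hasSum_dz_diag hq0 hq1 hle)⟩

theorem dbarSol_green {q : ℝ} (hq0 : 0 < q) (hq1 : q < 1) {f : Distr} (hf : IsFin f) :
    DbarSol q f (intMu q (inZ (dz q) (green q)) (conj q f)) := by
  have hqc : (q : ℂ) ≠ 0 := by exact_mod_cast hq0.ne'
  have ht : (1 - (q : ℂ) ^ 2) ≠ 0 := by exact_mod_cast (one_sub_sq_pos hq0 hq1).ne'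
  have hf2 : IsFin (yL q 1 (yR q 1 f)) := (hf.yR q 1).yL q 1
  -- `y f y^{-1} = (y f y) y^{-2}` turns the integral against `dμ` into a Green potential against
  -- `dν`.
  have e1 : conj q f = yR q (-2) (yL q 1 (yR q 1 f)) := by
    funext m n
    have : (q : ℂ) ^ (2 * (-1 : ℤ) * (n : ℤ))
        = (q : ℂ) ^ (2 * (1 : ℤ) * (n : ℤ)) * (q : ℂ) ^ (2 * (-2 : ℤ) * (n : ℤ)) := by
      rw [← zpow_add₀ hqc]; congr 1; ring
    simp only [conj, yL, yR, this]
    ring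
  have hc : IsFin (conj q f) := (hf.yR q (-1)).yL q 1
  rw [dz_intMu q _ hc, e1, ← intNu_eq_intMu]
  obtain ⟨N, C, hC, hband, hle⟩ := intNu_green_bound hq0 hq1 hf2
  have key := dbarSol_dz hq0 hq1 hC hband hle
  have e2 : dzbar q (dz q (intNu q (green q) (yL q 1 (yR q 1 f)))) = f := by
    funext a b
    have e3 : ∀ n : ℕ, (q : ℂ) ^ (2 * (1 : ℤ) * (n : ℤ)) = ((q : ℂ) ^ 2) ^ n := by
      intro n; rw [← pow_mul, ← zpow_natCast]; congr 1
    rw [dzbar_dz hq0, lap_intNu_green hq0 hq1 hf2]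
    simp only [yL, yR, e3]
    field_simp
  rwa [e2] at key

/-! ### The Bergman projection -/

/-- The kernel `∑_r e_r {(z ζ*)^r}`. -/
def toeplitzKer (q : ℝ) (e : ℕ → ℂ) : Ker := fun a b c d =>
  if a + c = b + d ∧ b ≤ a then e (a - b) * ((poch q d / poch q c : ℝ) : ℂ) else 0

theorem oneK_eq_toeplitzKer {q : ℝ} (hq0 : 0 < q) (hq1 : q < 1) :
    oneK = toeplitzKer q fun r => if r = 0 then 1 else 0 := by
  funext a b c d
  simp only [oneK, one, toeplitzKer]
  by_cases h : a + c = b + d ∧ b ≤ a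
  · rw [if_pos h]
    by_cases hab : a = b
    · subst hab
      have hcd : c = d := by omega
      subst hcd
      simp [(poch_pos hq0 hq1 c).ne']
    · have : a - b ≠ 0 := by omega
      simp [hab, this]
  · rw [if_neg h]
    by_cases hab : a = b
    · rw [if_neg (show ¬ c = d by omega), mul_zero]
    · rw [if_neg hab, zero_mul]

theorem geomR_toeplitzKer {q : ℝ} {t : ℂ} {e e' : ℕ → ℂ}
    (h0 : e' 0 = e 0) (h : ∀ r, e' (r + 1) = e (r + 1) + t * e' r) :
    geomR q t (toeplitzKer q e) = toeplitzKer q e' := by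
  apply geomR_eq_of_resolvent
  funext a b c d
  simp only [Pi.add_apply, Pi.smul_apply, smul_eq_mul, shiftR_apply, toeplitzKer]
  by_cases hs : a + c = b + d ∧ b ≤ a
  · rw [if_pos hs, if_pos hs]
    obtain ⟨r, rfl⟩ := Nat.exists_eq_add_of_le hs.2
    rcases r with _ | r
    · simp only [add_zero, Nat.sub_self, h0]
      split_ifs with h1 h2 h3
      · simp
      · simp
      · omega
      · simp
    · have hd : d = c + r + 1 := by omega
      subst hd
      have e1 : b + (r + 1) - b = r + 1 := by omega
      have e2 : b + (r + 1) - 1 - b = r := by omega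
      rw [if_neg (by omega), if_neg (by omega), if_pos (by omega), e1, e2, h, Nat.add_sub_cancel,
        poch_succ, pow_mul]
      push_cast
      ring
  · rw [if_neg hs, if_neg hs]
    split_ifs with h1 h2 h3
    · simp
    · simp
    · omega
    · simp

theorem bergman_eq {q : ℝ} (hq0 : 0 < q) (hq1 : q < 1) : bergman q =
    toeplitzKer q fun r => ∑ k ∈ Finset.range (r + 1), ((q : ℂ) ^ (-2 : ℤ)) ^ k := by
  rw [bergman, oneK_eq_toeplitzKer hq0 hq1,
    geomR_toeplitzKer (e' := fun _ => 1) (by simp) (by simp), geomR_toeplitzKer]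
  · simp
  · intro r
    rw [Finset.sum_range_succ', Finset.mul_sum, add_comm]
    simp [pow_succ']

/-- Moving `dζ` to the left multiplies the `r`-th coefficient by `t^r`, which reverses `∑_{k ≤ r}
t^{-k}` into `∑_{k ≤ r} t^k = (1 - t^{r+1}) / (1 - t)`: the reciprocal squared norm of `z^r`, up to
the factor `1 - t`. -/
theorem conjInv_bergman {q : ℝ} (hq0 : 0 < q) (hq1 : q < 1) (a b c d : ℕ) :
    (1 - (q : ℂ) ^ 2) * inZeta (conjInv q) (bergman q) a b c d =
      toeplitzKer q (fun r => 1 - ((q : ℂ) ^ 2) ^ (r + 1)) a b c d := by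
  have hqc : (q : ℂ) ≠ 0 := by exact_mod_cast hq0.ne'
  rw [bergman_eq hq0 hq1]
  simp only [inZeta, conjInv, yL, yR, toeplitzKer]
  by_cases hs : a + c = b + d ∧ b ≤ a
  · rw [if_pos hs, if_pos hs]
    obtain ⟨r, rfl⟩ := Nat.exists_eq_add_of_le hs.2
    have hd : d = c + r := by omega
    subst hd
    rw [Nat.add_sub_cancel_left]
    have e1 : (q : ℂ) ^ (2 * (-1 : ℤ) * (c : ℤ)) * (q : ℂ) ^ (2 * (1 : ℤ) * ((c + r : ℕ) : ℤ))
        = ((q : ℂ) ^ 2) ^ r := by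
      rw [← zpow_add₀ hqc, ← pow_mul, ← zpow_natCast]; congr 1; push_cast; ring
    have e2 : ((q : ℂ) ^ 2) ^ r * ∑ k ∈ Finset.range (r + 1), ((q : ℂ) ^ (-2 : ℤ)) ^ k
        = ∑ k ∈ Finset.range (r + 1), ((q : ℂ) ^ 2) ^ k := by
      rw [← Finset.sum_range_reflect (fun k => ((q : ℂ) ^ 2) ^ k), Finset.mul_sum]
      apply Finset.sum_congr rfl
      intro k hk
      simp only [Finset.mem_range] at hk
      obtain ⟨j, rfl⟩ := Nat.exists_eq_add_of_le (Nat.lt_succ_iff.1 hk)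
      rw [show k + j + 1 - 1 - k = j by omega, pow_add, show (q : ℂ) ^ (-2 : ℤ) = ((q : ℂ) ^ 2)⁻¹ by
        rw [zpow_neg]; rfl, inv_pow]
      field_simp
    have e3 := mul_neg_geom_sum ((q : ℂ) ^ 2) (r + 1)
    rw [← e3, ← e2, ← e1]
    ring
  · rw [if_neg hs, if_neg hs]
    ring

theorem tendsto_poch_div {q : ℝ} (hq0 : 0 < q) (hq1 : q < 1) (k : ℕ) :
    Tendsto (fun n => poch q (n + k) / poch q n) atTop (𝓝 1) := by
  induction k with
  | zero =>
    refine tendsto_const_nhds.congr fun n => ?_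
    rw [add_zero, div_self (poch_pos hq0 hq1 n).ne']
  | succ k ih =>
    have h := ih.mul (tendsto_const_nhds (x := (1 : ℝ)) |>.sub (tendsto_pow_sq hq0 hq1 (k + 1)))
    rw [sub_zero, mul_one] at h
    refine h.congr fun n => ?_
    rw [← add_assoc, poch_succ]
    ring

/-- The squared norm of `z^k`, up to the factor `1 - q²`. -/
theorem hasSum_weight {q : ℝ} (hq0 : 0 < q) (hq1 : q < 1) (k : ℕ) :
    HasSum (fun n => weight q (n + k) n) (1 - (q ^ 2) ^ (k + 1))⁻¹ := by
  have hk := (one_sub_pow_pos hq0 hq1 k).ne'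
  have hs : Summable fun n => (1 - (q ^ 2) ^ (k + 1)) * weight q (n + k) n := by
    refine Summable.mul_left _ (Summable.of_nonneg_of_le (fun n => (weight_pos hq0 hq1 _ _).le)
      (fun n => ?_) (summable_pow_sq hq0 hq1))
    have h1 := poch_add_div_le_one hq0 hq1 n k
    rw [weight]
    exact mul_le_of_le_one_left (by positivity) h1
  -- A discrete primitive of the weight times `1 - t^{k+1}`, rising from `0` to the limit `1`.
  let v : ℕ → ℝ := fun n => poch q (n + k) / poch q n * (1 - (q ^ 2) ^ n)
  have hstep : ∀ n, (1 - (q ^ 2) ^ (k + 1)) * weight q (n + k) n = v (n + 1) - v n := by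
    intro n
    have h1 := (poch_pos hq0 hq1 n).ne'
    have h2 := (one_sub_pow_pos hq0 hq1 n).ne'
    simp only [v, weight]
    rw [show n + 1 + k = n + k + 1 by ring, poch_succ q n, poch_succ q (n + k)]
    field_simp
    ring
  have hv : Tendsto v atTop (𝓝 1) := by
    have := (tendsto_poch_div hq0 hq1 k).mul
      (tendsto_const_nhds (x := (1 : ℝ)) |>.sub (tendsto_pow_sq hq0 hq1 0))
    simpa [v] using this
  have hl := hs.hasSum.tendsto_sum_nat
  simp only [hstep, Finset.sum_range_sub] at hl
  have h0 : v 0 = 0 := by simp [v]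
  simp only [h0, sub_zero] at hl
  have h1 := hs.hasSum.mul_left (1 - (q ^ 2) ^ (k + 1))⁻¹
  simp only [hstep, tendsto_nhds_unique hl hv, mul_one] at h1
  refine h1.congr_fun fun n => ?_
  rw [← hstep]
  field_simp

/-- The coefficients of the Bergman projection of `f`. -/
def bergmanCoeff (q : ℝ) (N : ℕ) (f : Distr) (k : ℕ) : ℂ := (1 - ((q : ℂ) ^ 2) ^ (k + 1)) *
  ∑ c ∈ Finset.range (N + 1), f (c + k) c * ((weight q (c + k) c : ℝ) : ℂ)

theorem intMu_bergman {q : ℝ} (hq0 : 0 < q) (hq1 : q < 1) {f : Distr} {N : ℕ}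
    (h : ∀ m n, f m n ≠ 0 → m ≤ N ∧ n ≤ N) (a b : ℕ) :
    intMu q (inZeta (conjInv q) (bergman q)) f a b
      = if b ≤ a then bergmanCoeff q N f (a - b) else 0 := by
  simp only [intMu_eq_sum q _ h, Finset.sum_product]
  have h1 : ∀ c d, (1 - (q : ℂ) ^ 2) * f d c * ((q : ℂ) ^ 2) ^ c
      * inZeta (conjInv q) (bergman q) a b c d = f d c * ((q : ℂ) ^ 2) ^ c *
        toeplitzKer q (fun r => 1 - ((q : ℂ) ^ 2) ^ (r + 1)) a b c d := by
    intro c d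
    rw [← conjInv_bergman hq0 hq1]; ring
  simp only [h1, toeplitzKer]
  split_ifs with hba
  · rw [bergmanCoeff, Finset.mul_sum]
    apply Finset.sum_congr rfl
    intro c hc
    obtain ⟨k, rfl⟩ := Nat.exists_eq_add_of_le hba
    rw [Finset.sum_eq_single (c + k)]
    · rw [if_pos ⟨by omega, by omega⟩, weight, Nat.add_sub_cancel_left]
      push_cast
      ring
    · intro d _ hd
      rw [if_neg (by omega), mul_zero]
    · intro hmem
      have : f (c + k) c = 0 := by
        by_contra hne
        have := h _ _ hne
        simp only [Finset.mem_range] at hmem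
        omega
      rw [this]; simp
  · apply Finset.sum_eq_zero
    intro c _
    apply Finset.sum_eq_zero
    intro d _
    rw [if_neg (by tauto), mul_zero]

theorem bergmanCoeff_eq_zero (q : ℝ) {f : Distr} {N k : ℕ}
    (h : ∀ m n, f m n ≠ 0 → m ≤ N ∧ n ≤ N) (hk : N < k) : bergmanCoeff q N f k = 0 := by
  rw [bergmanCoeff, Finset.sum_eq_zero, mul_zero]
  intro c _
  have : f (c + k) c = 0 := by
    by_contra hne
    have := h _ _ hne
    omega
  rw [this, zero_mul]

/-- The Bergman integral of `f` is a polynomial in `z`, hence in the kernel of `∂̄`. Its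
coefficients are normalized by `hasSum_weight` so that subtracting it makes every weighted diagonal
sum of `f` vanish. -/
theorem dbarSol_sub_bergman {q : ℝ} (hq0 : 0 < q) (hq1 : q < 1) {f : Distr} (hf : IsFin f) :
    DbarSol q (dzbar q f) (f - intMu q (inZeta (conjInv q) (bergman q)) f) := by
  obtain ⟨N, h⟩ := hf.exists_bound
  set g := intMu q (inZeta (conjInv q) (bergman q)) f with hg
  have hgab : ∀ a b, g a b = if b ≤ a then bergmanCoeff q N f (a - b) else 0 :=
    fun a b => intMu_bergman hq0 hq1 h a b
  have hband : IsBand N g := by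
    intro a b hab
    rw [hgab] at hab
    split_ifs at hab with hba
    · have : ¬ N < a - b := fun hlt => hab (bergmanCoeff_eq_zero q h hlt)
      omega
    · exact absurd rfl hab
  have hgm : MemL2 q 0 g := by
    refine memL2_of_isBand hq0 hq1
      (C := ∑ k ∈ Finset.range (N + 1), ‖bergmanCoeff q N f k‖ ^ 2) hband fun a b => ?_
    have e : q ^ (2 * ((0 : ℤ) + 1) * (b : ℤ)) = (q ^ 2) ^ b := by
      rw [← pow_mul, ← zpow_natCast]; congr 1
    have hnn : 0 ≤ ∑ k ∈ Finset.range (N + 1), ‖bergmanCoeff q N f k‖ ^ 2 :=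
      Finset.sum_nonneg fun k _ => by positivity
    rw [e]
    apply mul_le_mul_of_nonneg_right _ (by positivity)
    by_cases h0 : g a b = 0
    · rw [h0]; simpa using hnn
    · have hb := hband a b h0
      rw [hgab] at h0 ⊢
      split_ifs at h0 ⊢ with hba
      · exact Finset.single_le_sum (f := fun k => ‖bergmanCoeff q N f k‖ ^ 2)
          (fun k _ => by positivity) (Finset.mem_range.2 (by omega))
      · exact absurd rfl h0
  have hgk : dzbar q g = 0 := by
    rw [dzbar_eq_zero_iff hq0 hq1]
    intro m n
    rw [hgab, zL]
    rcases m with _ | m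
    · simp
    · rw [if_neg (Nat.succ_ne_zero m), hgab, Nat.add_sub_cancel, Nat.add_sub_add_right]
      simp only [Nat.add_le_add_iff_right]
  have hm : MemL2 q 0 (f - g) := (hf.memL2 q 0).sub hq0 hq1 hgm
  refine ⟨hm, by rw [dzbar_sub, hgk, sub_zero], fun p hp hpk =>
    scal_eq_zero_of_diag hq0 hq1 hm hp hpk fun k => ?_⟩
  have hs1 : HasSum (fun n => f (n + k) n * ((weight q (n + k) n : ℝ) : ℂ))
      (∑ n ∈ Finset.range (N + 1), f (n + k) n * ((weight q (n + k) n : ℝ) : ℂ)) := by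
    apply hasSum_sum_of_ne_finset_zero
    intro n hn
    have : f (n + k) n = 0 := by
      by_contra hne
      have := h _ _ hne
      simp only [Finset.mem_range] at hn
      omega
    rw [this, zero_mul]
  have hs2 := (Complex.hasSum_ofReal.2 (hasSum_weight hq0 hq1 k)).mul_left (bergmanCoeff q N f k)
  have hs3 := hs1.sub hs2
  have hk : (1 - ((q : ℂ) ^ 2) ^ (k + 1)) ≠ 0 := by
    exact_mod_cast (one_sub_pow_pos hq0 hq1 k).ne'
  have hz : ∑ n ∈ Finset.range (N + 1), f (n + k) n * ((weight q (n + k) n : ℝ) : ℂ)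
      - bergmanCoeff q N f k * (((1 - (q ^ 2) ^ (k + 1))⁻¹ : ℝ) : ℂ) = 0 := by
    rw [bergmanCoeff]
    push_cast
    field_simp
    ring
  rw [hz] at hs3
  refine hs3.congr_fun fun n => ?_
  rw [Pi.sub_apply, Pi.sub_apply, hgab, if_pos (by omega), Nat.add_sub_cancel_left]
  ring

theorem neg_inv_two_pi_smul_intForm (q : ℝ) (K : Ker) (f : Distr) :
    (-(1 / (2 * (Real.pi : ℂ) * Complex.I))) • intForm q K f = intMu q K f := by
  have : 2 * (Real.pi : ℂ) * Complex.I ≠ 0 := Complex.two_pi_I_ne_zero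
  rw [intForm, smul_smul, neg_mul_neg, one_div, inv_mul_cancel₀ this, one_smul]

end

end QDisc

/-! ### The main theorem -/

open QDisc
theorem proposition4p1 (q : ℝ) (hq0 : 0 < q) (hq1 : q < 1) :
    (HasSum (greenSummand q) (green q) ∧
      ∀ f : Distr, IsFin f → PoissonSol q f (intNu q (green q) f)) ∧
    ∀ f : Distr, IsFin f →
      (∃! u : Distr, DbarSol q f u) ∧
      (∀ u : Distr, DbarSol q f u →
        u = (-(1 / (2 * (Real.pi : ℂ) * Complex.I))) •
          intFormRight q (inZ (dz q) (green q)) f) ∧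
      f = (-(1 / (2 * (Real.pi : ℂ) * Complex.I))) • intFormLeft q (bergman q) f
        - (1 / (2 * (Real.pi : ℂ) * Complex.I)) •
          intFormRight q (inZ (dz q) (green q)) (dzbar q f) := by
  refine ⟨⟨hasSum_green hq0 hq1, fun f hf => poissonSol_green hq0 hq1 hf⟩, fun f hf => ⟨?_, ?_, ?_⟩⟩
  · exact ⟨_, dbarSol_green hq0 hq1 hf, fun v hv =>
      dbarSol_unique hq0 hq1 hv (dbarSol_green hq0 hq1 hf)⟩
  · intro u hu
    rw [intFormRight, neg_inv_two_pi_smul_intForm]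
    exact dbarSol_unique hq0 hq1 hu (dbarSol_green hq0 hq1 hf)
  -- Both the Bergman remainder of `f` and the Green integral of `∂̄ f` solve the problem with data
  -- `∂̄ f`, again a finite function.
  · have key := dbarSol_unique hq0 hq1 (dbarSol_sub_bergman hq0 hq1 hf)
      (dbarSol_green hq0 hq1 (hf.dzbar q))
    rw [sub_eq_add_neg, ← neg_smul, intFormRight, intFormLeft, neg_inv_two_pi_smul_intForm,
      neg_inv_two_pi_smul_intForm, ← key, add_sub_cancel]
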